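/- Let $f:[-1,1]\to\mathbb R$ be a $C^1$ shear profile (for example $f(z)=z$, Couette, or $f(z)=1-z^2$, Poiseuille), let $a,b>0$ and $\mathrm{Re}>0$, and let $\Omega=[0,2\pi/a]\times[0,2\pi/b]\times[-1,1]$ be the periodicity cell of the layer $\mathbb R^2\times[-1,1]$, with $(\cdot,\cdot)$ and $\|\cdot\|$ the scalar product and norm of $L^2(\Omega)$. Let $\mathcal S$ be the set of kinematically admissible fields: all $\mathbf u=(u,v,w)$ with $u,v,w\in H^1(\Omega)$, periodic in $x$ and $y$ with periods $2\pi/a$ and $2\pi/b$, vanishing (in the sense of traces) on $z=\pm1$, with $u_x+v_y+w_z=0$ and $\|\nabla\mathbf u\|>0$. Let $\mathrm{Re}_E\in(0,\infty]$ be defined by $$\frac1{\mathrm{Re}_E}=\sup_{\mathbf u\in\mathcal S}\frac{-(f'w,u)}{\|\nabla u\|^2+\|\nabla v\|^2+\|\nabla w\|^2}$$ (the maximum of the Reynolds–Orr ratio), a finite nonnegative number, where $1/\infty=0$. Let $0<T\le\infty$ and let $\mathbf u=(u,v,w)$, $p$ be a classical solution on $[0,T)$ of the perturbation equations of the flow $\mathbf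 U=f(z)\mathbf i$, $$\begin{aligned}u_t&=-\mathbf u\cdot\nabla u+\mathrm{Re}^{-1}\Delta u-(fu_x+f'w)-p_x,\\ v_t&=-\mathbf u\cdot\nabla v+\mathrm{Re}^{-1}\Delta v-fv_x-p_y,\\ w_t&=-\mathbf u\cdot\nabla w+\mathrm{Re}^{-1}\Delta w-fw_x-p_z,\\ u_x&+v_y+w_z=0,\end{aligned}$$ with $\mathbf u=0$ on $z=\pm1$ and with $\mathbf u$ and $p$ periodic in $x$ and $y$ with periods $2\pi/a$ and $2\pi/b$. Here classical means that for $0<t<T$ the velocity is $C^2$ and the pressure $C^1$ in space up to $z=\pm1$, that $\mathbf u_t$ exists and is continuous on $(0,T)\times\mathbb R^2\times[-1,1]$, and that the initial value $\mathbf u(0)\in L^2(\Omega)^3$ is attained in $L^2(\Omega)$ as $t\to0^+$. Let $E(t)=\frac12(\|u\|^2+\|v\|^2+\|w\|^2)$. If $\mathrm{Re}<\mathrm{Re}_E$, then $\frac1{\mathrm{Re}_E}-\frac1{\mathrm{Re}}<0$ and the flow $f(z)\mathbf i$ is nonlinearly, monotonically and exponentially stable in the energy norm: for every such solution, whatever the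 size of its initial value, $E$ is nonincreasing on $[0,T)$, $E(t)<E(s)$ whenever $0\le s<t<T$ and $E(s)>0$, and $$E(t)\le E(0)\exp\left\{\frac{\pi^2}{2}\left(\frac1{\mathrm{Re}_E}-\frac1{\mathrm{Re}}\right)t\right\}\qquad\text{for all }0\le t<T.$$ In particular, for $T=\infty$ this holds for all $t\ge0$. -/

import Mathlib

open MeasureTheory Set Filter Topology
open scoped ENNReal ContDiff

noncomputable section

namespace ShearFlow

/-- Points `X = (x, y, z)` of space: `X 0 = x`, `X 1 = y`, `X 2 = z`.
(The norm of this type is never used, only its topology and Lebesgue measure.) -/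
abbrev Pt : Type := Fin 3 → ℝ

/-- The closed layer `ℝ² × [-1, 1]`. -/
def layer : Set Pt := {X | X 2 ∈ Icc (-1 : ℝ) 1}

/-- The open layer `ℝ² × (-1, 1)`. -/
def openLayer : Set Pt := {X | X 2 ∈ Ioo (-1 : ℝ) 1}

/-- The periodicity cell `Ω = [0, 2π/a] × [0, 2π/b] × [-1, 1]`. -/
def cell (a b : ℝ) : Set Pt := Icc ![0, 0, -1] ![2 * Real.pi / a, 2 * Real.pi / b, 1]

/-- Periodicity on the layer, with period `2π/a` in `x` and `2π/b` in `y`. -/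
def PeriodicXY {α : Type} (a b : ℝ) (g : Pt → α) : Prop :=
  ∀ X ∈ layer, g (X + Pi.single 0 (2 * Real.pi / a)) = g X ∧
    g (X + Pi.single 1 (2 * Real.pi / b)) = g X

/-- The classical partial derivative `∂g/∂X_j`. -/
def pd (j : Fin 3) (g : Pt → ℝ) (X : Pt) : ℝ := fderiv ℝ g X (Pi.single j 1)

/-- The derivative `f'` of a shear profile `f : [-1, 1] → ℝ` (one-sided at `±1`). -/
def profileDeriv (f : ℝ → ℝ) (z : ℝ) : ℝ := derivWithin f (Icc (-1) 1) z

/-- The energy `½ (‖u‖² + ‖v‖² + ‖w‖²)` of the field `U = (u, v, w)`, with the norm of `L²(Ω)`. -/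
def energy (a b : ℝ) (U : Pt → Fin 3 → ℝ) : ℝ :=
  1 / 2 * ∑ i, ∫ X in cell a b, U X i ^ 2

/-- The production term `-(f' w, u)`. -/
def production (f : ℝ → ℝ) (a b : ℝ) (U : Pt → Fin 3 → ℝ) : ℝ :=
  -∫ X in cell a b, profileDeriv f (X 2) * U X 2 * U X 0

/-- `‖∇u‖² + ‖∇v‖² + ‖∇w‖²`, where `G X i j` is the `j`-th partial derivative at `X` of the
`i`-th component. -/
def gradNormSq (a b : ℝ) (G : Pt → Fin 3 → Fin 3 → ℝ) : ℝ :=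
  ∑ i, ∑ j, ∫ X in cell a b, G X i j ^ 2

/-- `U = (u, v, w)` is a kinematically admissible field and `G` is its weak gradient:
`u, v, w` are in `H¹(Ω)`, periodic in `x` and `y`, zero on the planes `z = ±1`,
`u_x + v_y + w_z = 0` and `‖∇U‖ > 0`. -/
structure KinematicallyAdmissible (a b : ℝ) (U : Pt → Fin 3 → ℝ)
    (G : Pt → Fin 3 → Fin 3 → ℝ) : Prop where
  periodic : PeriodicXY a b U
  periodic_grad : PeriodicXY a b G
  memLp : ∀ i, MemLp (fun X => U X i) 2 (volume.restrict (cell a b))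
  memLp_grad : ∀ i j, MemLp (fun X => G X i j) 2 (volume.restrict (cell a b))
  /-- `G` is the weak gradient of `U` in the layer, and the trace of `U` on `z = ±1` is zero.
  Test functions supported in the open layer say that `G` is the weak gradient. Those that do
  not vanish on `z = ±1` say moreover that Green's formula has no boundary term, which is to say
  that the traces of the components of `U` on `z = ±1` are zero. Test functions may
  cross the lateral faces of the cell, so that the periodic extension of `U` has no jump there. -/
  weak_grad : ∀ φ : Pt → ℝ, ContDiff ℝ ∞ φ → HasCompactSupport φ → ∀ i j,
    ∫ X in layer, U X i * pd j φ X = -∫ X in layer, G X i j * φ X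
  div_free : ∀ᵐ X ∂(volume.restrict (cell a b)), ∑ i, G X i i = 0
  grad_pos : 0 < gradNormSq a b G

/-- The values of the Reynolds-Orr ratio `-(f' w, u) / ‖∇U‖²` on the kinematically admissible
fields. -/
def ratioSet (f : ℝ → ℝ) (a b : ℝ) : Set ℝ :=
  {r | ∃ U G, KinematicallyAdmissible a b U G ∧ r = production f a b U / gradNormSq a b G}

/-- The critical energy Reynolds number `Re_E`, where `1 / Re_E` is the largest value (the
supremum) of the Reynolds-Orr ratio; `Re_E = ∞` if this value is `0`. -/
def criticalRe (f : ℝ → ℝ) (a b : ℝ) : ℝ≥0∞ :=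
  (ENNReal.ofReal (sSup (ratioSet f a b)))⁻¹

/-- `(U, p)` is a classical solution, for times in `[0, T)` with `T ≤ ∞`, of the
perturbation equations of the plane shear flow `f(z) i` at Reynolds number `Re`. It is periodic
in `x` and `y`, it satisfies the rigid boundary conditions, and it attains its initial
value `U 0` in `L²(Ω)`. -/
structure IsPerturbation (f : ℝ → ℝ) (Re a b : ℝ) (T : EReal)
    (U : ℝ → Pt → Fin 3 → ℝ) (p : ℝ → Pt → ℝ) : Prop where
  /-- For `t > 0` the velocity is `C²` and the pressure is `C¹` in space, up to `z = ±1`. -/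
  smooth_velocity : ∀ t : ℝ, 0 < t → (t : EReal) < T → ContDiffOn ℝ 2 (U t) layer
  smooth_pressure : ∀ t : ℝ, 0 < t → (t : EReal) < T → ContDiffOn ℝ 1 (p t) layer
  /-- For `t > 0` the velocity is `C¹` in time, its time derivative being jointly continuous. -/
  time_diff : ∀ t : ℝ, 0 < t → (t : EReal) < T → ∀ X ∈ layer,
    DifferentiableAt ℝ (fun s => U s X) t
  time_cont : ContinuousOn (fun q : ℝ × Pt => deriv (fun s => U s q.2) q.1)
    ({t : ℝ | 0 < t ∧ (t : EReal) < T} ×ˢ layer)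
  periodic_velocity : ∀ t : ℝ, 0 < t → (t : EReal) < T → PeriodicXY a b (U t)
  periodic_pressure : ∀ t : ℝ, 0 < t → (t : EReal) < T → PeriodicXY a b (p t)
  momentum : ∀ t : ℝ, 0 < t → (t : EReal) < T → ∀ X ∈ openLayer, ∀ i : Fin 3,
    deriv (fun s => U s X i) t =
      -(∑ j, U t X j * pd j (fun Y => U t Y i) X)
        + 1 / Re * ∑ j, pd j (pd j (fun Y => U t Y i)) X
        - (f (X 2) * pd 0 (fun Y => U t Y i) X
            + if i = 0 then profileDeriv f (X 2) * U t X 2 else 0)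
        - pd i (p t) X
  div_free : ∀ t : ℝ, 0 < t → (t : EReal) < T → ∀ X ∈ openLayer,
    ∑ i, pd i (fun Y => U t Y i) X = 0
  no_slip : ∀ t : ℝ, 0 < t → (t : EReal) < T → ∀ X : Pt, X 2 = -1 ∨ X 2 = 1 → U t X = 0
  initial_memLp : ∀ i, MemLp (fun X => U 0 X i) 2 (volume.restrict (cell a b))
  initial_tendsto : Tendsto (fun t => ∑ i, ∫ X in cell a b, (U t X i - U 0 X i) ^ 2)
    (𝓝[>] 0) (𝓝 0)

end ShearFlow

end

/-! The proof is the energy method. Multiplying the momentum equation by the velocity and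
integrating over the cell, the inertial term, the advection by `f` and the pressure become
divergences and contribute nothing: their fluxes cancel on lateral faces by periodicity and vanish
on the walls. What remains is the Reynolds–Orr identity E' = -(f'w, u) - ‖∇U‖²/Re
(`integral_velocity_mul_acceleration`, `IsPerturbation.hasDerivAt_energy`).

With m = 1/Re_E the production is at most m‖∇U‖², hence E' ≤ (m - 1/Re)‖∇U‖². The factor is
negative, so the Poincaré inequality ‖∇U‖² ≥ (π²/2)E (`poincare_cell`, `energy_le_gradNormSq`) turns
this into E' ≤ (π²/2)(m - 1/Re)E, and Grönwall gives the decay from every positive time. The L²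
attainment of the initial value extends it to time 0 (`IsPerturbation.energy_le_mul_exp`).
Monotonicity and strict decrease are read off the same estimate between two times.

It remains to see that 1/Re_E is a genuine supremum (`isLUB_ratioSet`). The ratio takes the value 0
on a parallel flow, and it is bounded above by a Poincaré inequality for weak fields. That
inequality is proved by duality: a test function is written as the vertical derivative of its
primitive `zPrimitive`, and the weak gradient is tested against that primitive. -/

namespace ShearFlow

/-! ### The layer and the cell -/

lemma isClosed_layer : IsClosed layer := isClosed_Icc.preimage (continuous_apply 2)

lemma isOpen_openLayer : IsOpen openLayer := isOpen_Ioo.preimage (continuous_apply 2)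

lemma openLayer_subset_layer : openLayer ⊆ layer := fun _ h => Ioo_subset_Icc_self h

lemma convex_layer : Convex ℝ layer :=
  (convex_Icc (-1 : ℝ) 1).linear_preimage (LinearMap.proj (R := ℝ) (φ := fun _ : Fin 3 => ℝ) 2)

lemma layer_mem_nhds {X : Pt} (hX : X ∈ openLayer) : layer ∈ 𝓝 X :=
  mem_of_superset (isOpen_openLayer.mem_nhds hX) openLayer_subset_layer

lemma uniqueDiffOn_layer : UniqueDiffOn ℝ layer := by
  refine uniqueDiffOn_convex convex_layer ⟨0, ?_⟩
  rw [mem_interior_iff_mem_nhds]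
  exact layer_mem_nhds (by simp [openLayer])

lemma Icc_subset_layer {l r : Pt} (hl : l 2 = -1) (hr : r 2 = 1) : Icc l r ⊆ layer :=
  fun _ hX => ⟨hl ▸ hX.1 2, hr ▸ hX.2 2⟩

lemma cell_subset_layer (a b : ℝ) : cell a b ⊆ layer := Icc_subset_layer rfl rfl

lemma isCompact_cell (a b : ℝ) : IsCompact (cell a b) := isCompact_Icc

lemma measurableSet_cell (a b : ℝ) : MeasurableSet (cell a b) := measurableSet_Icc

open scoped Pointwise in
lemma single_vadd_layer {i : Fin 3} (hi : i ≠ 2) (c : ℝ) :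
    (Pi.single i c : Pt) +ᵥ layer = layer := by
  ext X
  rw [Set.mem_vadd_set_iff_neg_vadd_mem]
  simp [layer, hi.symm]

lemma pi_Ioo_ae_eq_Icc (l r : Pt) :
    (pi univ fun i => Ioo (l i) (r i) : Set Pt) =ᵐ[volume] Icc l r :=
  Measure.univ_pi_Ioo_ae_eq_Icc

/-- A property of the points of the open layer holds almost everywhere in a box of the layer. -/
lemma ae_mem_interior (l r : Pt) :
    ∀ᵐ X ∂(volume.restrict (Icc l r)), X ∈ pi univ fun i => Ioo (l i) (r i) := by
  rw [← Measure.restrict_congr_set (pi_Ioo_ae_eq_Icc l r)]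
  exact ae_restrict_mem (MeasurableSet.univ_pi fun _ => measurableSet_Ioo)

lemma pi_Ioo_subset_openLayer {l r : Pt} (hl : l 2 = -1) (hr : r 2 = 1) :
    (pi univ fun i => Ioo (l i) (r i) : Set Pt) ⊆ openLayer :=
  fun _ hX => ⟨hl ▸ (hX 2 (mem_univ _)).1, hr ▸ (hX 2 (mem_univ _)).2⟩

lemma ae_mem_openLayer {l r : Pt} (hl : l 2 = -1) (hr : r 2 = 1) :
    ∀ᵐ X ∂(volume.restrict (Icc l r)), X ∈ openLayer :=
  (ae_mem_interior l r).mono fun _ hX => pi_Ioo_subset_openLayer hl hr hX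

lemma ae_cell_mem_openLayer (a b : ℝ) : ∀ᵐ X ∂(volume.restrict (cell a b)), X ∈ openLayer :=
  ae_mem_openLayer rfl rfl

lemma cell_le {a b : ℝ} (ha : 0 < a) (hb : 0 < b) :
    (![0, 0, -1] : Pt) ≤ ![2 * Real.pi / a, 2 * Real.pi / b, 1] := by
  intro i
  fin_cases i <;> simp <;> positivity

/-! ### The divergence theorem on boxes -/

/-- A vector field that takes the same values on opposite faces of a box, in the direction
normal to them, has total divergence zero. -/
lemma integral_divergence_eq_zero {l r : Pt} (hle : l ≤ r) (F : Fin 3 → Pt → ℝ) (g : Pt → ℝ)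
    (hF : ∀ j, ContinuousOn (F j) (Icc l r))
    (hd : ∀ X ∈ pi univ fun i => Ioo (l i) (r i), ∀ j, DifferentiableAt ℝ (F j) X)
    (hg : IntegrableOn g (Icc l r))
    (hdiv : ∀ X ∈ pi univ fun i => Ioo (l i) (r i), ∑ j, pd j (F j) X = g X)
    (hface : ∀ j, ∀ X ∈ Icc l r, X j = l j → F j (X + Pi.single j (r j - l j)) = F j X) :
    ∫ X in Icc l r, g X = 0 := by
  have hae : (fun X => ∑ j, fderiv ℝ (F j) X (Pi.single j 1)) =ᵐ[volume.restrict (Icc l r)] g :=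
    (ae_mem_interior l r).mono fun X hX => hdiv X hX
  rw [← integral_congr_ae hae, integral_divergence_of_hasFDerivAt_off_countable' l r hle F
    (fun j X => fderiv ℝ (F j) X) ∅ countable_empty hF
    (fun X hX j => (hd X hX.1 j).hasFDerivAt) ((integrable_congr hae).2 hg)]
  refine Finset.sum_eq_zero fun j _ => sub_eq_zero.2 ?_
  refine setIntegral_congr_fun measurableSet_Icc fun y hy => ?_
  have hX : j.insertNth (l j) y ∈ Icc l r := by
    rw [Fin.insertNth_mem_Icc]
    exact ⟨left_mem_Icc.2 (hle j), hy⟩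
  have := hface j _ hX (by simp)
  -- The point of the far face over `y` is the near-face point translated by the side length, so
  -- `hface` equates the two face integrands.
  refine Eq.trans ?_ this
  congr 1
  ext i
  refine j.succAboveCases ?_ (fun k => ?_) i
  · simp
  · simp [Fin.succAbove_ne]

/-! ### Rules for partial derivatives -/

section pd

variable {j : Fin 3} {g h : Pt → ℝ} {X : Pt}

lemma pd_add (hg : DifferentiableAt ℝ g X) (hh : DifferentiableAt ℝ h X) :
    pd j (fun Y => g Y + h Y) X = pd j g X + pd j h X := by
  simp [pd, fderiv_fun_add hg hh]

lemma pd_sub (hg : DifferentiableAt ℝ g X) (hh : DifferentiableAt ℝ h X) :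
    pd j (fun Y => g Y - h Y) X = pd j g X - pd j h X := by
  simp [pd, fderiv_fun_sub hg hh]

lemma pd_mul (hg : DifferentiableAt ℝ g X) (hh : DifferentiableAt ℝ h X) :
    pd j (fun Y => g Y * h Y) X = g X * pd j h X + h X * pd j g X := by
  simp [pd, fderiv_fun_mul hg hh]

lemma pd_const_mul (c : ℝ) (hg : DifferentiableAt ℝ g X) :
    pd j (fun Y => c * g Y) X = c * pd j g X := by
  simp [pd, fderiv_const_mul hg]

lemma pd_sq (hg : DifferentiableAt ℝ g X) :
    pd j (fun Y => g Y ^ 2) X = 2 * g X * pd j g X := by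
  simp only [sq]
  rw [pd_mul hg hg]
  ring

lemma pd_comp_apply {q : ℝ → ℝ} {d : ℝ} {k : Fin 3} (hq : HasDerivAt q d (X k)) :
    DifferentiableAt ℝ (fun Y : Pt => q (Y k)) X ∧
      pd j (fun Y : Pt => q (Y k)) X = if j = k then d else 0 := by
  have h1 : HasFDerivAt (fun Y : Pt => q (Y k)) _ X :=
    hq.comp_hasFDerivAt X (ContinuousLinearMap.proj (R := ℝ) (φ := fun _ : Fin 3 => ℝ) k).hasFDerivAt
  refine ⟨h1.differentiableAt, ?_⟩
  rw [pd, h1.fderiv]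
  simp [Pi.single_apply, eq_comm]

end pd

/-! ### The gradient up to the boundary -/

/-- The partial derivative within the layer, which on the planes `z = ±1` is one-sided. -/
noncomputable def pdLayer (j : Fin 3) (u : Pt → ℝ) (X : Pt) : ℝ :=
  fderivWithin ℝ u layer X (Pi.single j 1)

lemma pdLayer_eq_pd {u : Pt → ℝ} {X : Pt} (hX : X ∈ openLayer) (j : Fin 3) :
    pdLayer j u X = pd j u X := by
  rw [pdLayer, fderivWithin_of_mem_nhds (layer_mem_nhds hX), pd]

/-- Reconciles the second derivatives in the momentum equation, which iterate `pd`, with energy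
fluxes built from `pdLayer`, which is continuous up to the walls. -/
lemma pd_pdLayer {u : Pt → ℝ} {X : Pt} (hX : X ∈ openLayer) (j k : Fin 3) :
    pd k (pdLayer j u) X = pd k (pd j u) X := by
  have : pdLayer j u =ᶠ[𝓝 X] pd j u :=
    mem_of_superset (isOpen_openLayer.mem_nhds hX) fun Y hY => pdLayer_eq_pd hY j
  rw [pd, pd, this.fderiv_eq]

lemma contDiffOn_pdLayer {u : Pt → ℝ} {m n : WithTop ℕ∞} (hu : ContDiffOn ℝ n u layer)
    (hmn : m + 1 ≤ n) (j : Fin 3) : ContDiffOn ℝ m (pdLayer j u) layer :=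
  (hu.fderivWithin uniqueDiffOn_layer hmn).clm_apply contDiffOn_const

lemma continuousOn_pdLayer {u : Pt → ℝ} (hu : ContDiffOn ℝ 1 u layer) (j : Fin 3) :
    ContinuousOn (pdLayer j u) layer :=
  (contDiffOn_pdLayer (m := 0) hu (by simp) j).continuousOn

open scoped Pointwise in
-- Horizontal translations map the layer onto itself, so they commute with differentiation within
-- it.
lemma pdLayer_add_single {u : Pt → ℝ} {i : Fin 3} (hi : i ≠ 2) {c : ℝ}
    (hu : ∀ X ∈ layer, u (X + Pi.single i c) = u X) (j : Fin 3) :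
    ∀ X ∈ layer, pdLayer j u (X + Pi.single i c) = pdLayer j u X := by
  intro X hX
  have h := fderivWithin_comp_add_right (𝕜 := ℝ) (f := u) (s := layer) (x := X) (Pi.single i c)
  rw [single_vadd_layer hi] at h
  rw [pdLayer, ← h, fderivWithin_congr hu (hu X hX), pdLayer]

lemma PeriodicXY.pdLayer {a b : ℝ} {u : Pt → ℝ} (hu : PeriodicXY a b u) (j : Fin 3) :
    PeriodicXY a b (pdLayer j u) := fun X hX =>
  ⟨pdLayer_add_single (by decide) (fun Y hY => (hu Y hY).1) j X hX,
    pdLayer_add_single (by decide) (fun Y hY => (hu Y hY).2) j X hX⟩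

lemma differentiableAt_of_contDiffOn {u : Pt → ℝ} (hu : ContDiffOn ℝ 1 u layer) {X : Pt}
    (hX : X ∈ openLayer) : DifferentiableAt ℝ u X :=
  (hu.contDiffAt (layer_mem_nhds hX)).differentiableAt one_ne_zero

lemma integrableOn_cell {a b : ℝ} {g : Pt → ℝ} (hg : ContinuousOn g layer) :
    IntegrableOn g (cell a b) :=
  (hg.mono (cell_subset_layer a b)).integrableOn_compact (isCompact_cell a b)

lemma memLp_cell {a b : ℝ} {g : Pt → ℝ} (hg : ContinuousOn g layer) :
    MemLp g 2 (volume.restrict (cell a b)) :=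
  (memLp_two_iff_integrable_sq
    (integrableOn_cell hg).aestronglyMeasurable).2 (integrableOn_cell (hg.pow 2))

/-! ### Fields that are continuously differentiable up to the boundary -/

/-- Brings integrals over the unbounded layer to a box, where the divergence theorem applies. The
box has the full height of the layer, so only the horizontal extent of `g` matters. -/
lemma setIntegral_layer_eq {l r : Pt} (hl : l 2 = -1) (hr : r 2 = 1) {g : Pt → ℝ}
    (hg : ∀ X, X ∉ pi univ (fun i => if i = 2 then univ else Icc (l i) (r i)) → g X = 0) :
    ∫ X in layer, g X = ∫ X in Icc l r, g X := by
  refine setIntegral_eq_of_subset_of_forall_sdiff_eq_zero isClosed_layer.measurableSet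
    (Icc_subset_layer hl hr) fun X hX => hg X fun h => hX.2 ?_
  rw [← pi_univ_Icc]
  intro i hi
  by_cases h2 : i = 2
  · subst h2
    simpa [hl, hr] using! hX.1
  · simpa [h2] using h i hi

/-- Green's formula for a function that vanishes on `z = ±1`. -/
lemma integral_mul_pd {u φ : Pt → ℝ} (hu : ContDiffOn ℝ 1 u layer)
    (h0 : ∀ X : Pt, X 2 = -1 ∨ X 2 = 1 → u X = 0) (hφ : ContDiff ℝ ∞ φ)
    (hc : HasCompactSupport φ) (j : Fin 3) :
    ∫ X in layer, u X * pd j φ X = -∫ X in layer, pdLayer j u X * φ X := by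
  obtain ⟨R, hR0, hR⟩ := hc.isCompact.isBounded.subset_closedBall_lt 0 0
  have hzero : ∀ X : Pt, ∀ i, R < |X i| → X ∉ tsupport φ := fun X i hi hX => by
    have h1 : ‖X‖ ≤ R := by simpa using hR hX
    exact absurd ((norm_le_pi_norm X i).trans h1) (not_le.2 hi)
  -- The margin 1 puts the lateral faces strictly outside the support of `φ`.
  set l : Pt := ![-(R + 1), -(R + 1), -1] with hl
  set r : Pt := ![R + 1, R + 1, 1] with hr
  have hlr : l ≤ r := by
    intro i
    fin_cases i <;> simp [hl, hr] <;> linarith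
  have hout : ∀ X, X ∉ pi univ (fun i => if i = 2 then univ else Icc (l i) (r i)) →
      X ∉ tsupport φ := by
    intro X hX hXs
    refine hX fun i _ => ?_
    have hi : |X i| ≤ R := not_lt.1 fun h => hzero X i h hXs
    rw [abs_le] at hi
    fin_cases i <;> simp [hl, hr] <;> constructor <;> simp at hi <;> linarith
  have hdφ : Continuous (pd j φ) := (hφ.continuous_fderiv (by simp)).clm_apply continuous_const
  have hD := continuousOn_pdLayer hu j
  have hsub : Icc l r ⊆ layer := Icc_subset_layer rfl rfl
  have hi1 : IntegrableOn (fun X => u X * pd j φ X) (Icc l r) :=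
    ((hu.continuousOn.mul hdφ.continuousOn).mono hsub).integrableOn_compact isCompact_Icc
  have hi2 : IntegrableOn (fun X => pdLayer j u X * φ X) (Icc l r) :=
    ((hD.mul hφ.continuous.continuousOn).mono hsub).integrableOn_compact isCompact_Icc
  rw [setIntegral_layer_eq (l := l) (r := r) rfl rfl,
    setIntegral_layer_eq (l := l) (r := r) rfl rfl, ← add_eq_zero_iff_eq_neg,
    ← integral_add hi1 hi2]
  -- The field is `u φ` in direction `j`: its flux vanishes on the walls because of `u`, on the
  -- lateral faces because of `φ`.
  · refine integral_divergence_eq_zero hlr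
      (fun k X => (if k = j then 1 else 0) * (u X * φ X)) _
      (fun k => continuousOn_const.mul ((hu.continuousOn.mono hsub).mul hφ.continuous.continuousOn))
      ?_ (hi1.add hi2) ?_ ?_
    · intro X hX k
      have hX' : X ∈ openLayer := pi_Ioo_subset_openLayer (l := l) (r := r) rfl rfl hX
      exact ((differentiableAt_of_contDiffOn hu hX').mul
        (hφ.differentiable (by simp) X)).const_mul _
    · intro X hX
      have hX' : X ∈ openLayer := pi_Ioo_subset_openLayer (l := l) (r := r) rfl rfl hX
      have h1 := differentiableAt_of_contDiffOn hu hX'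
      have h2 : DifferentiableAt ℝ φ X := hφ.differentiable (by simp) X
      simp only [pd_const_mul _ (h1.fun_mul h2), pd_mul h1 h2]
      simp [pdLayer_eq_pd hX', mul_comm]
    · intro k X _ hk
      by_cases h2 : k = 2
      · subst h2
        rw [h0 X (Or.inl hk), h0 (X + _) (Or.inr (by simp [hk, hr]))]
        simp
      · have hb : |l k| = R + 1 ∧ |r k| = R + 1 := by
          have h3 : |R + 1| = R + 1 := abs_of_pos (by linarith)
          fin_cases k
          · exact ⟨(abs_neg _).trans h3, h3⟩
          · exact ⟨(abs_neg _).trans h3, h3⟩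
          · exact absurd rfl h2
        rw [image_eq_zero_of_notMem_tsupport (hzero X k (by rw [hk]; linarith)),
          image_eq_zero_of_notMem_tsupport (hzero (X + _) k (by simp [hk]; linarith))]
        simp
  · intro X hX
    rw [image_eq_zero_of_notMem_tsupport (hout X hX), mul_zero]
  · intro X hX
    have : fderiv ℝ φ X = 0 :=
      image_eq_zero_of_notMem_tsupport fun h => hout X hX (tsupport_fderiv_subset ℝ h)
    simp [pd, this]

/-- The Poincaré inequality across the layer, with its sharp constant. -/
lemma poincare_cell {a b : ℝ} (ha : 0 < a) (hb : 0 < b) {u : Pt → ℝ}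
    (hu : ContDiffOn ℝ 1 u layer) (h0 : ∀ X : Pt, X 2 = -1 ∨ X 2 = 1 → u X = 0) :
    Real.pi ^ 2 / 4 * ∫ X in cell a b, u X ^ 2 ≤ ∫ X in cell a b, pdLayer 2 u X ^ 2 := by
  -- Completing the square: u_z² - c²u² equals (u_z + c tan(cz) u)² minus the z-derivative `g` of c
  -- tan(cz) u², which integrates to zero. For c < π/2 the tangent is smooth up to the walls; the
  -- sharp constant comes from letting c tend to π/2.
  have key : ∀ c ∈ Ioo 0 (Real.pi / 2),
      c ^ 2 * ∫ X in cell a b, u X ^ 2 ≤ ∫ X in cell a b, pdLayer 2 u X ^ 2 := by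
    intro c hc
    have hcos : ∀ X ∈ layer, Real.cos (c * X 2) ≠ 0 := by
      intro X hX
      refine (Real.cos_pos_of_mem_Ioo ⟨?_, ?_⟩).ne' <;> nlinarith [hX.1, hX.2, hc.1, hc.2]
    have htan : ContinuousOn (fun X : Pt => Real.tan (c * X 2)) layer := by
      intro X hX
      have h : ContinuousAt (fun X : Pt => c * X 2) X :=
        (continuous_const.mul (continuous_apply 2)).continuousAt
      exact ((Real.continuousAt_tan.2 (hcos X hX)).comp
        (f := fun X : Pt => c * X 2) h).continuousWithinAt
    have hD := continuousOn_pdLayer hu 2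
    have huc := hu.continuousOn
    set g : Pt → ℝ := fun X => c ^ 2 * (1 + Real.tan (c * X 2) ^ 2) * u X ^ 2 +
      2 * c * Real.tan (c * X 2) * u X * pdLayer 2 u X with hg
    have hgc : ContinuousOn g layer := by
      simp only [hg]
      fun_prop
    have hg0 : ∫ X in cell a b, g X = 0 := by
      refine integral_divergence_eq_zero (cell_le ha hb)
        (fun k X => (if k = 2 then c else 0) * (Real.tan (c * X 2) * u X ^ 2)) g
        (fun k => ContinuousOn.mono (by fun_prop) (cell_subset_layer a b)) ?_
        (integrableOn_cell hgc) ?_ ?_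
      · intro X hX k
        have hX' : X ∈ openLayer := pi_Ioo_subset_openLayer rfl rfl hX
        have h1 := differentiableAt_of_contDiffOn hu hX'
        have h2 := (pd_comp_apply (j := k) (k := 2) (X := X)
          ((Real.hasDerivAt_tan (hcos X (openLayer_subset_layer hX'))).comp _
            ((hasDerivAt_id (X 2)).const_mul c))).1
        exact (h2.mul (h1.pow 2)).const_mul _
      · intro X hX
        have hX' : X ∈ openLayer := pi_Ioo_subset_openLayer rfl rfl hX
        have h1 := differentiableAt_of_contDiffOn hu hX'
        have hcX := hcos X (openLayer_subset_layer hX')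
        obtain ⟨h2, h3⟩ := pd_comp_apply (j := 2) (k := 2) (X := X)
          ((Real.hasDerivAt_tan hcX).comp _ ((hasDerivAt_id (X 2)).const_mul c))
        simp only [Function.comp_def, if_true] at h2 h3
        have h4 : DifferentiableAt ℝ (fun Y : Pt => Real.tan (c * Y 2) * u Y ^ 2) X :=
          h2.fun_mul (h1.fun_pow 2)
        simp only [pd_const_mul _ h4]
        rw [Fin.sum_univ_three, if_neg (by decide), if_neg (by decide), if_pos rfl,
          pd_mul (j := 2) h2 (h1.fun_pow 2), pd_sq h1, h3, hg]
        simp only [pdLayer_eq_pd hX']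
        have : 1 / Real.cos (c * X 2) ^ 2 = 1 + Real.tan (c * X 2) ^ 2 := by
          rw [← Real.inv_one_add_tan_sq hcX, one_div, inv_inv]
        rw [this]
        ring
      · intro k X _ hk
        by_cases h2 : k = 2
        · subst h2
          rw [h0 X (Or.inl hk), h0 (X + _) (Or.inr (by rw [Pi.add_apply, hk]; simp))]
          simp
        · simp [h2]
    have hsq : ∫ X in cell a b, (pdLayer 2 u X + c * Real.tan (c * X 2) * u X) ^ 2 =
        (∫ X in cell a b, pdLayer 2 u X ^ 2) + (∫ X in cell a b, g X) -
          c ^ 2 * ∫ X in cell a b, u X ^ 2 := by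
      have hDi : IntegrableOn (fun X => pdLayer 2 u X ^ 2) (cell a b) := integrableOn_cell (hD.pow 2)
      have hui : IntegrableOn (fun X => u X ^ 2) (cell a b) := integrableOn_cell (huc.pow 2)
      have hgi := integrableOn_cell (a := a) (b := b) hgc
      have hDgi : IntegrableOn (fun X => pdLayer 2 u X ^ 2 + g X) (cell a b) := hDi.add hgi
      rw [← integral_const_mul, ← integral_add hDi hgi, ← integral_sub hDgi (hui.const_mul _)]
      refine integral_congr_ae (Eventually.of_forall fun X => ?_)
      simp only [hg]
      ring
    have : 0 ≤ ∫ X in cell a b, (pdLayer 2 u X + c * Real.tan (c * X 2) * u X) ^ 2 :=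
      integral_nonneg fun X => sq_nonneg _
    rw [hsq, hg0] at this
    linarith
  have hlim : Tendsto (fun c : ℝ => c ^ 2 * ∫ X in cell a b, u X ^ 2) (𝓝[<] (Real.pi / 2))
      (𝓝 ((Real.pi / 2) ^ 2 * ∫ X in cell a b, u X ^ 2)) :=
    ((by fun_prop : Continuous fun c : ℝ => c ^ 2 * ∫ X in cell a b, u X ^ 2).tendsto _).mono_left
      nhdsWithin_le_nhds
  have := le_of_tendsto hlim (mem_of_superset (Ioo_mem_nhdsLT Real.pi_div_two_pos) key)
  rwa [div_pow, show (2 : ℝ) ^ 2 = 4 by norm_num] at this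

/-- The gradient up to the boundary of the components of a field. -/
noncomputable def gradLayer (U : Pt → Fin 3 → ℝ) (X : Pt) (i j : Fin 3) : ℝ :=
  pdLayer j (fun Y => U Y i) X

/-- Lets the supremum over weak fields be applied to a classical solution at a fixed time. -/
lemma kinematicallyAdmissible_of_contDiffOn {a b : ℝ} {U : Pt → Fin 3 → ℝ}
    (hU : ContDiffOn ℝ 1 U layer) (hper : PeriodicXY a b U)
    (h0 : ∀ X : Pt, X 2 = -1 ∨ X 2 = 1 → U X = 0)
    (hdiv : ∀ X ∈ openLayer, ∑ i, pd i (fun Y => U Y i) X = 0)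
    (hpos : 0 < gradNormSq a b (gradLayer U)) :
    KinematicallyAdmissible a b U (gradLayer U) where
  periodic := hper
  periodic_grad X hX := by
    have h : ∀ i j, _ := fun i j => PeriodicXY.pdLayer (a := a) (b := b) (u := fun Y => U Y i)
      (fun Y hY => ⟨congrFun (hper Y hY).1 i, congrFun (hper Y hY).2 i⟩) j X hX
    exact ⟨funext₂ fun i j => (h i j).1, funext₂ fun i j => (h i j).2⟩
  memLp i := memLp_cell (contDiffOn_pi.1 hU i).continuousOn
  memLp_grad i j := memLp_cell (continuousOn_pdLayer (contDiffOn_pi.1 hU i) j)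
  weak_grad φ hφ hc i j := integral_mul_pd (contDiffOn_pi.1 hU i)
    (fun X hX => congrFun (h0 X hX) i) hφ hc j
  div_free := (ae_cell_mem_openLayer a b).mono fun X hX => by
    simpa only [gradLayer, pdLayer_eq_pd hX] using hdiv X hX
  grad_pos := hpos

/-- Poincaré's inequality bounds the energy by the squared norm of the gradient. -/
lemma energy_le_gradNormSq {a b : ℝ} (ha : 0 < a) (hb : 0 < b) {U : Pt → Fin 3 → ℝ}
    (hU : ContDiffOn ℝ 1 U layer) (h0 : ∀ X : Pt, X 2 = -1 ∨ X 2 = 1 → U X = 0) :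
    Real.pi ^ 2 / 2 * energy a b U ≤ gradNormSq a b (gradLayer U) := by
  have h : Real.pi ^ 2 / 2 * energy a b U =
      ∑ i, Real.pi ^ 2 / 4 * ∫ X in cell a b, U X i ^ 2 := by
    rw [energy, ← Finset.mul_sum]
    ring
  rw [h, gradNormSq]
  refine Finset.sum_le_sum fun i _ => ?_
  refine (poincare_cell ha hb (contDiffOn_pi.1 hU i) fun X hX => congrFun (h0 X hX) i).trans ?_
  exact Finset.single_le_sum (f := fun j => ∫ X in cell a b, gradLayer U X i j ^ 2)
    (fun j _ => integral_nonneg fun X => sq_nonneg _) (Finset.mem_univ 2)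

/-! ### Shear profiles and the production term -/

lemma continuousOn_profileDeriv {f : ℝ → ℝ} (hf : ContDiffOn ℝ 1 f (Icc (-1) 1)) :
    ContinuousOn (fun X : Pt => profileDeriv f (X 2)) layer :=
  (hf.continuousOn_derivWithin (uniqueDiffOn_Icc (by norm_num)) le_rfl).comp
    (continuous_apply 2).continuousOn fun _ hX => hX

lemma hasDerivAt_profile {f : ℝ → ℝ} (hf : ContDiffOn ℝ 1 f (Icc (-1) 1)) {X : Pt}
    (hX : X ∈ openLayer) : HasDerivAt f (profileDeriv f (X 2)) (X 2) :=
  (hf.differentiableOn one_ne_zero _ (openLayer_subset_layer hX)).hasDerivWithinAt.hasDerivAt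
    (Icc_mem_nhds hX.1 hX.2)

lemma exists_abs_profileDeriv_le {f : ℝ → ℝ} (hf : ContDiffOn ℝ 1 f (Icc (-1) 1)) :
    ∃ C, 0 ≤ C ∧ ∀ z ∈ Icc (-1 : ℝ) 1, |profileDeriv f z| ≤ C := by
  obtain ⟨C, hC⟩ := isCompact_Icc.exists_bound_of_continuousOn
    (hf.continuousOn_derivWithin (uniqueDiffOn_Icc (by norm_num)) le_rfl)
  exact ⟨C, (norm_nonneg _).trans (hC 0 (by norm_num)), hC⟩

lemma energy_nonneg (a b : ℝ) (U : Pt → Fin 3 → ℝ) : 0 ≤ energy a b U :=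
  mul_nonneg (by norm_num) (Finset.sum_nonneg fun _ _ => integral_nonneg fun _ => sq_nonneg _)

lemma gradNormSq_nonneg (a b : ℝ) (G : Pt → Fin 3 → Fin 3 → ℝ) : 0 ≤ gradNormSq a b G :=
  Finset.sum_nonneg fun _ _ => Finset.sum_nonneg fun _ _ => integral_nonneg fun _ => sq_nonneg _

/-- From 2|wu| ≤ u² + w². It serves both to bound the Reynolds–Orr ratio and to treat fields with
zero gradient, where the ratio is unavailable. -/
lemma abs_production_le {f : ℝ → ℝ} {C : ℝ} (hC0 : 0 ≤ C)
    (hC : ∀ z ∈ Icc (-1 : ℝ) 1, |profileDeriv f z| ≤ C) (a b : ℝ) {U : Pt → Fin 3 → ℝ}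
    (hU : ∀ i, MemLp (fun X => U X i) 2 (volume.restrict (cell a b))) :
    |production f a b U| ≤ C * energy a b U := by
  have hi : ∀ i, IntegrableOn (fun X => U X i ^ 2) (cell a b) := fun i => (hU i).integrable_sq
  have hs : ∫ X in cell a b, C / 2 * (U X 0 ^ 2 + U X 2 ^ 2) =
      C / 2 * ((∫ X in cell a b, U X 0 ^ 2) + ∫ X in cell a b, U X 2 ^ 2) := by
    rw [integral_const_mul, integral_add (hi 0) (hi 2)]
  have h1 : 0 ≤ ∫ X in cell a b, U X 1 ^ 2 := integral_nonneg fun X => sq_nonneg _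
  calc |production f a b U|
      = ‖∫ X in cell a b, profileDeriv f (X 2) * U X 2 * U X 0‖ := by
        rw [production, abs_neg, Real.norm_eq_abs]
    _ ≤ ∫ X in cell a b, C / 2 * (U X 0 ^ 2 + U X 2 ^ 2) := by
        refine norm_integral_le_of_norm_le (((hi 0).add (hi 2)).const_mul _) ?_
        refine (ae_restrict_mem (measurableSet_cell a b)).mono fun X hX => ?_
        have hX2 := hC _ (cell_subset_layer a b hX)
        have h2 : 2 * (|U X 2| * |U X 0|) ≤ U X 0 ^ 2 + U X 2 ^ 2 := by
          nlinarith [sq_nonneg (|U X 2| - |U X 0|), sq_abs (U X 0), sq_abs (U X 2)]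
        rw [Real.norm_eq_abs, abs_mul, abs_mul, mul_assoc]
        calc _ ≤ C * (|U X 2| * |U X 0|) := by gcongr
          _ ≤ C / 2 * (U X 0 ^ 2 + U X 2 ^ 2) := by nlinarith
    _ ≤ C * energy a b U := by
        rw [hs, energy, Fin.sum_univ_three]
        nlinarith

/-! ### The Reynolds-Orr energy balance -/

/-- The momentum equation, multiplied by the velocity and integrated over the cell. -/
lemma integral_velocity_mul_acceleration {f : ℝ → ℝ} (hf : ContDiffOn ℝ 1 f (Icc (-1) 1))
    {a b : ℝ} (Re : ℝ) (ha : 0 < a) (hb : 0 < b) {V A : Pt → Fin 3 → ℝ} {q : Pt → ℝ}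
    (hV : ContDiffOn ℝ 2 V layer) (hq : ContDiffOn ℝ 1 q layer) (hA : ContinuousOn A layer)
    (hVper : PeriodicXY a b V) (hqper : PeriodicXY a b q)
    (hmom : ∀ X ∈ openLayer, ∀ i : Fin 3, A X i =
      -(∑ j, V X j * pd j (fun Y => V Y i) X)
        + 1 / Re * ∑ j, pd j (pd j (fun Y => V Y i)) X
        - (f (X 2) * pd 0 (fun Y => V Y i) X
            + if i = 0 then profileDeriv f (X 2) * V X 2 else 0)
        - pd i q X)
    (hdiv : ∀ X ∈ openLayer, ∑ i, pd i (fun Y => V Y i) X = 0)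
    (h0 : ∀ X : Pt, X 2 = -1 ∨ X 2 = 1 → V X = 0) :
    ∫ X in cell a b, ∑ i, V X i * A X i =
      production f a b V - 1 / Re * gradNormSq a b (gradLayer V) := by
  have hv2 : ∀ i, ContDiffOn ℝ 2 (fun X => V X i) layer := contDiffOn_pi.1 hV
  have hv1 : ∀ i, ContDiffOn ℝ 1 (fun X => V X i) layer := fun i => (hv2 i).of_le (by norm_num)
  have hvc : ∀ i, ContinuousOn (fun X => V X i) layer := fun i => (hv1 i).continuousOn
  have hAc : ∀ i, ContinuousOn (fun X => A X i) layer := continuousOn_pi.1 hA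
  have hD1 : ∀ i j, ContDiffOn ℝ 1 (fun X => gradLayer V X i j) layer := fun i j =>
    contDiffOn_pdLayer (hv2 i) (by norm_num) j
  have hDc : ∀ i j, ContinuousOn (fun X => gradLayer V X i j) layer := fun i j =>
    (hD1 i j).continuousOn
  have hfc : ContinuousOn (fun X : Pt => f (X 2)) layer :=
    hf.continuousOn.comp (continuous_apply 2).continuousOn fun _ hX => hX
  have hf'c := continuousOn_profileDeriv hf
  have hqc := hq.continuousOn
  set S : Pt → ℝ := fun X => V X 0 ^ 2 + V X 1 ^ 2 + V X 2 ^ 2 with hS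
  set K : Fin 3 → Pt → ℝ := fun j X => V X 0 * gradLayer V X 0 j + V X 1 * gradLayer V X 1 j +
    V X 2 * gradLayer V X 2 j with hK
  -- The energy flux: viscous, inertial, basic-flow and pressure parts. Its divergence is the
  -- integrand of `key` below.
  set F : Fin 3 → Pt → ℝ := fun j X => 1 / Re * K j X - 1 / 2 * (V X j * S X) -
    (if j = 0 then 1 / 2 else 0) * (f (X 2) * S X) - q X * V X j with hF
  have hSc : ContinuousOn S layer :=
    (((hvc 0).pow 2).add ((hvc 1).pow 2)).add ((hvc 2).pow 2)
  have hKc : ∀ j, ContinuousOn (K j) layer := fun j =>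
    (((hvc 0).mul (hDc 0 j)).add ((hvc 1).mul (hDc 1 j))).add ((hvc 2).mul (hDc 2 j))
  have hFc : ∀ j, ContinuousOn (F j) layer := fun j =>
    (((continuousOn_const.mul (hKc j)).sub (continuousOn_const.mul ((hvc j).mul hSc))).sub
      (continuousOn_const.mul (hfc.mul hSc))).sub (hqc.mul (hvc j))
  have hi1 : IntegrableOn (fun X => ∑ i, V X i * A X i) (cell a b) :=
    integrableOn_cell (continuousOn_finsetSum _ fun i _ => (hvc i).mul (hAc i))
  have hi2 : IntegrableOn (fun X => profileDeriv f (X 2) * V X 2 * V X 0) (cell a b) :=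
    integrableOn_cell ((hf'c.mul (hvc 2)).mul (hvc 0))
  have hi3 : ∀ i j, IntegrableOn (fun X => gradLayer V X i j ^ 2) (cell a b) := fun i j =>
    integrableOn_cell ((hDc i j).pow 2)
  have hi4 : ∀ i, IntegrableOn (fun X => ∑ j, gradLayer V X i j ^ 2) (cell a b) := fun i =>
    integrable_finsetSum _ fun j _ => hi3 i j
  have hi5 : IntegrableOn (fun X => ∑ i, ∑ j, gradLayer V X i j ^ 2) (cell a b) :=
    integrable_finsetSum _ fun i _ => hi4 i
  have hi12 : IntegrableOn (fun X => (∑ i, V X i * A X i) +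
    profileDeriv f (X 2) * V X 2 * V X 0) (cell a b) := hi1.add hi2
  have hdiffF : ∀ X ∈ openLayer, ∀ j, DifferentiableAt ℝ (F j) X ∧
      pd j (F j) X = 1 / Re * ((V X 0 * pd j (pd j fun Y => V Y 0) X +
          V X 1 * pd j (pd j fun Y => V Y 1) X + V X 2 * pd j (pd j fun Y => V Y 2) X) +
          (gradLayer V X 0 j ^ 2 + gradLayer V X 1 j ^ 2 + gradLayer V X 2 j ^ 2)) -
        1 / 2 * (V X j * (2 * V X 0 * pd j (fun Y => V Y 0) X + 2 * V X 1 * pd j (fun Y => V Y 1) X +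
          2 * V X 2 * pd j (fun Y => V Y 2) X) + S X * pd j (fun Y => V Y j) X) -
        (if j = 0 then 1 / 2 else 0) * (f (X 2) * (2 * V X 0 * pd j (fun Y => V Y 0) X +
          2 * V X 1 * pd j (fun Y => V Y 1) X + 2 * V X 2 * pd j (fun Y => V Y 2) X)) -
        (q X * pd j (fun Y => V Y j) X + V X j * pd j q X) := by
    intro X hX j
    have dv : ∀ i, DifferentiableAt ℝ (fun Y => V Y i) X := fun i =>
      differentiableAt_of_contDiffOn (hv1 i) hX
    have dD : ∀ i, DifferentiableAt ℝ (fun Y => gradLayer V Y i j) X := fun i =>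
      differentiableAt_of_contDiffOn (hD1 i j) hX
    have dq : DifferentiableAt ℝ q X := differentiableAt_of_contDiffOn hq hX
    obtain ⟨df, pf⟩ := pd_comp_apply (j := j) (hasDerivAt_profile hf hX)
    have d01 : DifferentiableAt ℝ (fun Y => V Y 0 ^ 2 + V Y 1 ^ 2) X :=
      ((dv 0).fun_pow 2).fun_add ((dv 1).fun_pow 2)
    have dS : DifferentiableAt ℝ S X := d01.fun_add ((dv 2).fun_pow 2)
    have pS : pd j S X = 2 * V X 0 * pd j (fun Y => V Y 0) X +
        2 * V X 1 * pd j (fun Y => V Y 1) X + 2 * V X 2 * pd j (fun Y => V Y 2) X := by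
      rw [hS, pd_add d01 ((dv 2).fun_pow 2), pd_add ((dv 0).fun_pow 2) ((dv 1).fun_pow 2),
        pd_sq (dv 0), pd_sq (dv 1), pd_sq (dv 2)]
    have dVD : ∀ i, DifferentiableAt ℝ (fun Y => V Y i * gradLayer V Y i j) X := fun i =>
      (dv i).fun_mul (dD i)
    have pVD : ∀ i, pd j (fun Y => V Y i * gradLayer V Y i j) X =
        V X i * pd j (pd j fun Y => V Y i) X + gradLayer V X i j ^ 2 := fun i => by
      have h1 : gradLayer V X i j = pd j (fun Y => V Y i) X := pdLayer_eq_pd hX j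
      have h2 : pd j (fun Y => gradLayer V Y i j) X = pd j (pd j fun Y => V Y i) X :=
        pd_pdLayer hX j j
      rw [pd_mul (dv i) (dD i), h2, ← h1, sq]
    have dK : DifferentiableAt ℝ (K j) X := ((dVD 0).fun_add (dVD 1)).fun_add (dVD 2)
    have pK : pd j (K j) X = (V X 0 * pd j (pd j fun Y => V Y 0) X +
          V X 1 * pd j (pd j fun Y => V Y 1) X + V X 2 * pd j (pd j fun Y => V Y 2) X) +
          (gradLayer V X 0 j ^ 2 + gradLayer V X 1 j ^ 2 + gradLayer V X 2 j ^ 2) := by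
      simp only [hK]
      rw [pd_add ((dVD 0).fun_add (dVD 1)) (dVD 2), pd_add (dVD 0) (dVD 1), pVD, pVD, pVD]
      ring
    have d1 := dK.const_mul (1 / Re)
    have d2 := ((dv j).fun_mul dS).const_mul (1 / 2)
    have d3 := (df.fun_mul dS).const_mul (if j = 0 then 1 / 2 else 0)
    have d4 := dq.fun_mul (dv j)
    refine ⟨((d1.fun_sub d2).fun_sub d3).fun_sub d4, ?_⟩
    simp only [hF]
    rw [pd_sub ((d1.fun_sub d2).fun_sub d3) d4, pd_sub (d1.fun_sub d2) d3, pd_sub d1 d2,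
      pd_const_mul _ dK, pd_const_mul _ ((dv j).fun_mul dS), pd_const_mul _ (df.fun_mul dS),
      pd_mul dq (dv j), pd_mul (dv j) dS, pd_mul df dS, pK, pS, pf]
    by_cases hj : j = 0
    · subst hj
      simp
    · simp [hj]
  have key : ∫ X in cell a b, ((∑ i, V X i * A X i) + profileDeriv f (X 2) * V X 2 * V X 0 +
      1 / Re * ∑ i, ∑ j, gradLayer V X i j ^ 2) = 0 := by
    refine integral_divergence_eq_zero (cell_le ha hb) F _
      (fun j => (hFc j).mono (cell_subset_layer a b)) ?_ (hi12.add (hi5.const_mul _)) ?_ ?_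
    · exact fun X hX j => (hdiffF X (pi_Ioo_subset_openLayer rfl rfl hX) j).1
    · intro X hX
      have hX' : X ∈ openLayer := pi_Ioo_subset_openLayer rfl rfl hX
      have hd := hdiv X hX'
      have m0 := hmom X hX' 0
      have m1 := hmom X hX' 1
      have m2 := hmom X hX' 2
      simp only [Fin.sum_univ_three] at hd m0 m1 m2 ⊢
      rw [(hdiffF X hX' 0).2, (hdiffF X hX' 1).2, (hdiffF X hX' 2).2, m0, m1, m2]
      simp only [hS, if_true, if_neg (by decide : ¬(1 : Fin 3) = 0),
        if_neg (by decide : ¬(2 : Fin 3) = 0)]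
      -- The divergence of `V` is left over with factor -|V|²/2 from the inertial flux and -q from
      -- the pressure flux.
      linear_combination (-(V X 0 ^ 2 + V X 1 ^ 2 + V X 2 ^ 2) / 2 - q X) * hd
    · have hshift : ∀ {i : Fin 3}, i ≠ 2 → ∀ {c : ℝ},
          (∀ X ∈ layer, V (X + Pi.single i c) = V X) →
          (∀ X ∈ layer, q (X + Pi.single i c) = q X) →
          ∀ X ∈ layer, ∀ j, F j (X + Pi.single i c) = F j X := by
        intro i hi c hVc hqc X hX j
        have hg : ∀ k j, gradLayer V (X + Pi.single i c) k j = gradLayer V X k j := fun k j =>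
          pdLayer_add_single hi (fun Y hY => congrFun (hVc Y hY) k) j X hX
        have h2 : (X + Pi.single i c : Pt) 2 = X 2 := by simp [hi.symm]
        simp only [hF, hK, hS, hVc X hX, hqc X hX, hg, h2]
      intro k X hX hk
      have hXl := cell_subset_layer a b hX
      match k with
      | 0 =>
        have hc : (![2 * Real.pi / a, 2 * Real.pi / b, 1] : Pt) 0 - (![0, 0, -1] : Pt) 0 =
          2 * Real.pi / a := by simp
        rw [hc]
        exact hshift (by decide) (fun Y hY => (hVper Y hY).1) (fun Y hY => (hqper Y hY).1) X hXl 0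
      | 1 =>
        have hc : (![2 * Real.pi / a, 2 * Real.pi / b, 1] : Pt) 1 - (![0, 0, -1] : Pt) 1 =
          2 * Real.pi / b := by simp
        rw [hc]
        exact hshift (by decide) (fun Y hY => (hVper Y hY).2) (fun Y hY => (hqper Y hY).2) X hXl 1
      | 2 =>
        -- Every term of the flux carries a factor `V`, so no wall values of the gradient or
        -- pressure enter.
        have z1 : V X = 0 := h0 X (Or.inl hk)
        have z2 : V (X + Pi.single 2 ((![2 * Real.pi / a, 2 * Real.pi / b, 1] : Pt) 2 -
            (![0, 0, -1] : Pt) 2)) = 0 :=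
          h0 _ (Or.inr (by rw [Pi.add_apply, hk]; simp))
        simp only [hF, hK, hS, z1, z2, Pi.zero_apply]
        ring
  rw [integral_add hi12 (hi5.const_mul _), integral_add hi1 hi2, integral_const_mul,
    integral_finsetSum _ fun i _ => hi4 i] at key
  simp only [integral_finsetSum _ fun j _ => hi3 _ j] at key
  rw [production, gradNormSq]
  linarith

/-! ### Evolution of the energy -/

lemma isOpen_times (T : EReal) : IsOpen {t : ℝ | 0 < t ∧ (t : EReal) < T} :=
  (isOpen_Ioi (a := (0 : ℝ))).inter (isOpen_Iio.preimage continuous_coe_real_ereal)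

/-- Differentiation of the energy under the integral sign. -/
lemma hasDerivAt_energy {a b : ℝ} {J : Set ℝ} (hJ : IsOpen J) {U : ℝ → Pt → Fin 3 → ℝ}
    (hU : ∀ t ∈ J, ContinuousOn (U t) layer)
    (hdiff : ∀ t ∈ J, ∀ X ∈ layer, DifferentiableAt ℝ (fun s => U s X) t)
    (hcont : ContinuousOn (fun q : ℝ × Pt => deriv (fun s => U s q.2) q.1) (J ×ˢ layer))
    {t : ℝ} (ht : t ∈ J) :
    HasDerivAt (fun s => energy a b (U s))
      (∫ X in cell a b, ∑ i, U t X i * deriv (fun s => U s X) t i) t := by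
  obtain ⟨ε, hε, hball⟩ := Metric.nhds_basis_closedBall.mem_iff.1 (hJ.mem_nhds ht)
  have hKsub : Metric.closedBall t ε ×ˢ cell a b ⊆ J ×ˢ layer :=
    prod_mono hball (cell_subset_layer a b)
  obtain ⟨M, hM⟩ := ((isCompact_closedBall t ε).prod (isCompact_cell a b)).exists_bound_of_continuousOn
    (hcont.mono hKsub)
  obtain ⟨N, hN⟩ := (isCompact_cell a b).exists_bound_of_continuousOn
    ((hU t ht).mono (cell_subset_layer a b))
  -- Joint continuity of `U` is not assumed; a uniform bound near time `t` follows from the bound at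
  -- `t` and the mean value inequality.
  have hbound : ∀ s ∈ Metric.closedBall t ε, ∀ X ∈ cell a b, ‖U s X‖ ≤ N + M * ε := by
    intro s hs X hX
    have h1 := (convex_closedBall t ε).norm_image_sub_le_of_norm_deriv_le (𝕜 := ℝ)
      (f := fun s => U s X) (C := M) (x := t) (y := s)
      (fun r hr => hdiff r (hball hr) X (cell_subset_layer a b hX))
      (fun r hr => hM (r, X) ⟨hr, hX⟩) (Metric.mem_closedBall_self hε.le) hs
    have hM0 : 0 ≤ M := (norm_nonneg _).trans (hM (s, X) ⟨hs, hX⟩)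
    have h2 : M * ‖s - t‖ ≤ M * ε := by
      gcongr
      simpa [dist_eq_norm] using hs
    calc ‖U s X‖ = ‖U t X + (U s X - U t X)‖ := by rw [add_sub_cancel]
      _ ≤ ‖U t X‖ + ‖U s X - U t X‖ := norm_add_le _ _
      _ ≤ N + M * ε := add_le_add (hN X hX) (h1.trans h2)
  have hW : ContinuousOn (fun X => deriv (fun s => U s X) t) layer :=
    hcont.comp (f := fun X => (t, X)) (by fun_prop) fun X hX => ⟨ht, hX⟩
  have hcomp : ∀ i, Integrable (fun X => 2 * (U t X i * deriv (fun s => U s X) t i))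
      (volume.restrict (cell a b)) ∧
      HasDerivAt (fun s => ∫ X in cell a b, U s X i ^ 2)
        (∫ X in cell a b, 2 * (U t X i * deriv (fun s => U s X) t i)) t := by
    intro i
    refine hasDerivAt_integral_of_dominated_loc_of_deriv_le
      (F' := fun s X => 2 * (U s X i * deriv (fun s => U s X) s i))
      (bound := fun _ => 2 * ((N + M * ε) * M))
      (Metric.closedBall_mem_nhds t hε) ?_ ?_ ?_ ?_ ?_ ?_
    · filter_upwards [hJ.mem_nhds ht] with s hs
      exact (integrableOn_cell ((continuousOn_pi.1 (hU s hs) i).pow 2)).aestronglyMeasurable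
    · exact integrableOn_cell ((continuousOn_pi.1 (hU t ht) i).pow 2)
    · exact (integrableOn_cell (continuousOn_const.mul
        ((continuousOn_pi.1 (hU t ht) i).mul (continuousOn_pi.1 hW i)))).aestronglyMeasurable
    · refine (ae_restrict_mem (measurableSet_cell a b)).mono fun X hX s hs => ?_
      have h1 := (norm_le_pi_norm (U s X) i).trans (hbound s hs X hX)
      have h2 := (norm_le_pi_norm (deriv (fun s => U s X) s) i).trans (hM (s, X) ⟨hs, hX⟩)
      rw [norm_mul, norm_mul, Real.norm_ofNat]
      have := mul_le_mul h1 h2 (norm_nonneg _) ((norm_nonneg _).trans h1)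
      linarith
    · exact integrableOn_const (isCompact_cell a b).measure_lt_top.ne
    · refine (ae_restrict_mem (measurableSet_cell a b)).mono fun X hX s hs => ?_
      have h1 := hasDerivAt_pi.1 (hdiff s (hball hs) X (cell_subset_layer a b hX)).hasDerivAt i
      exact (h1.fun_pow 2).congr_deriv (by push_cast; ring)
  have hsum := (HasDerivAt.fun_sum fun i (_ : i ∈ Finset.univ) => (hcomp i).2).const_mul (1 / 2)
  refine hsum.congr_deriv ?_
  rw [← integral_finsetSum _ fun i _ => (hcomp i).1, ← integral_const_mul]
  refine integral_congr_ae (Eventually.of_forall fun X => ?_)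
  simp only [← Finset.mul_sum]
  ring

/-- Grönwall's inequality for a differential inequality on an interval. -/
lemma le_mul_exp_of_hasDerivAt_le {E E' : ℝ → ℝ} {k s t : ℝ} (hst : s ≤ t)
    (hE : ∀ r ∈ Icc s t, HasDerivAt E (E' r) r) (hle : ∀ r ∈ Icc s t, E' r ≤ k * E r) :
    E t ≤ E s * Real.exp (k * (t - s)) := by
  have hd : ∀ r ∈ Icc s t, HasDerivAt (fun r => E r * Real.exp (-k * r))
      (E' r * Real.exp (-k * r) + E r * (Real.exp (-k * r) * (-k * 1))) r := fun r hr =>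
    (hE r hr).mul ((hasDerivAt_id r).const_mul (-k)).exp
  have hanti : AntitoneOn (fun r => E r * Real.exp (-k * r)) (Icc s t) := by
    refine antitoneOn_of_deriv_nonpos (convex_Icc s t)
      (fun r hr => (hd r hr).continuousAt.continuousWithinAt)
      (fun r hr => (hd r (interior_subset hr)).differentiableAt.differentiableWithinAt)
      fun r hr => ?_
    rw [(hd r (interior_subset hr)).deriv]
    have := mul_le_mul_of_nonneg_right (hle r (interior_subset hr)) (Real.exp_pos (-k * r)).le
    linarith
  have h := hanti (left_mem_Icc.2 hst) (right_mem_Icc.2 hst) hst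
  calc E t = E t * Real.exp (-k * t) * Real.exp (k * t) := by
        rw [mul_assoc, ← Real.exp_add]
        simp
    _ ≤ E s * Real.exp (-k * s) * Real.exp (k * t) :=
        mul_le_mul_of_nonneg_right h (Real.exp_pos _).le
    _ = E s * Real.exp (k * (t - s)) := by
        rw [mul_assoc, ← Real.exp_add]
        ring_nf

/-- Two fields that are close in `L²` have nearly the same energy. -/
lemma energy_le_of_sub {a b ε : ℝ} (hε : 0 < ε) {U V : Pt → Fin 3 → ℝ}
    (hU : ∀ i, MemLp (fun X => U X i) 2 (volume.restrict (cell a b)))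
    (hV : ∀ i, MemLp (fun X => V X i) 2 (volume.restrict (cell a b))) :
    energy a b U ≤ (1 + ε) * energy a b V +
      (1 + ε⁻¹) / 2 * ∑ i, ∫ X in cell a b, (U X i - V X i) ^ 2 := by
  have h : ∀ i, ∫ X in cell a b, U X i ^ 2 ≤ (1 + ε) * (∫ X in cell a b, V X i ^ 2) +
      (1 + ε⁻¹) * ∫ X in cell a b, (U X i - V X i) ^ 2 := by
    intro i
    have h1 : IntegrableOn (fun X => (1 + ε) * V X i ^ 2) (cell a b) :=
      (hV i).integrable_sq.const_mul _
    have h2 : IntegrableOn (fun X => (1 + ε⁻¹) * (U X i - V X i) ^ 2) (cell a b) :=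
      ((hU i).sub (hV i)).integrable_sq.const_mul _
    rw [← integral_const_mul, ← integral_const_mul, ← integral_add h1 h2]
    refine integral_mono (hU i).integrable_sq (h1.add h2) fun X => ?_
    -- Young's inequality for U = V + (U - V), with its defect written as a square.
    have h3 : (1 + ε) * V X i ^ 2 + (1 + ε⁻¹) * (U X i - V X i) ^ 2 - U X i ^ 2 =
        ε⁻¹ * (ε * V X i - (U X i - V X i)) ^ 2 := by
      field_simp
      ring
    have h4 : 0 ≤ ε⁻¹ * (ε * V X i - (U X i - V X i)) ^ 2 := by positivity
    simp only
    linarith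
  have := Finset.sum_le_sum fun i (_ : i ∈ Finset.univ) => h i
  rw [Finset.sum_add_distrib, ← Finset.mul_sum, ← Finset.mul_sum] at this
  rw [energy, energy]
  linarith

section solution

variable {f : ℝ → ℝ} {a b Re : ℝ} {T : EReal} {U : ℝ → Pt → Fin 3 → ℝ} {p : ℝ → Pt → ℝ}

/-- The Reynolds-Orr energy identity. -/
lemma IsPerturbation.hasDerivAt_energy (hf : ContDiffOn ℝ 1 f (Icc (-1) 1)) (ha : 0 < a)
    (hb : 0 < b) (h : IsPerturbation f Re a b T U p) {t : ℝ} (ht : 0 < t) (htT : (t : EReal) < T) :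
    HasDerivAt (fun s => energy a b (U s))
      (production f a b (U t) - 1 / Re * gradNormSq a b (gradLayer (U t))) t := by
  have hA : ContinuousOn (fun X => deriv (fun s => U s X) t) layer :=
    h.time_cont.comp (f := fun X => (t, X)) (by fun_prop) fun X hX => ⟨⟨ht, htT⟩, hX⟩
  refine (ShearFlow.hasDerivAt_energy (isOpen_times T)
    (fun s hs => (h.smooth_velocity s hs.1 hs.2).continuousOn)
    (fun s hs => h.time_diff s hs.1 hs.2) h.time_cont ⟨ht, htT⟩).congr_deriv ?_
  refine integral_velocity_mul_acceleration hf Re ha hb (h.smooth_velocity t ht htT)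
    (h.smooth_pressure t ht htT) hA (h.periodic_velocity t ht htT) (h.periodic_pressure t ht htT)
    (fun X hX i => ?_) (h.div_free t ht htT) (h.no_slip t ht htT)
  rw [← h.momentum t ht htT X hX i]
  exact ((hasDerivAt_pi.1 (h.time_diff t ht htT X (openLayer_subset_layer hX)).hasDerivAt i).deriv).symm

/-- An upper bound `m < 1 / Re` of the Reynolds-Orr ratio gives exponential decay. -/
lemma IsPerturbation.energy_le_mul_exp (hf : ContDiffOn ℝ 1 f (Icc (-1) 1)) (ha : 0 < a)
    (hb : 0 < b) (h : IsPerturbation f Re a b T U p) {m : ℝ} (hm : m ∈ upperBounds (ratioSet f a b))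
    (hmRe : m - 1 / Re < 0) {s t : ℝ} (hs : 0 ≤ s) (hst : s ≤ t) (htT : (t : EReal) < T) :
    energy a b (U t) ≤
      energy a b (U s) * Real.exp (Real.pi ^ 2 / 2 * (m - 1 / Re) * (t - s)) := by
  have hT : ∀ {r : ℝ}, r ≤ t → (r : EReal) < T := fun hr =>
    (EReal.coe_le_coe_iff.2 hr).trans_lt htT
  have hmem : ∀ {r : ℝ}, 0 < r → r ≤ t → ∀ i,
      MemLp (fun X => U r X i) 2 (volume.restrict (cell a b)) := fun hr hrt i =>
    memLp_cell (contDiffOn_pi.1 (h.smooth_velocity _ hr (hT hrt)) i).continuousOn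
  have hpos : ∀ {s : ℝ}, 0 < s → s ≤ t → energy a b (U t) ≤
      energy a b (U s) * Real.exp (Real.pi ^ 2 / 2 * (m - 1 / Re) * (t - s)) := by
    intro s hs hst
    refine le_mul_exp_of_hasDerivAt_le (E := fun r => energy a b (U r)) hst
      (fun r hr => h.hasDerivAt_energy hf ha hb (hs.trans_le hr.1) (hT hr.2)) fun r hr => ?_
    have hr0 := hs.trans_le hr.1
    have hC1 : ContDiffOn ℝ 1 (U r) layer :=
      (h.smooth_velocity r hr0 (hT hr.2)).of_le (by norm_num)
    have hns := h.no_slip r hr0 (hT hr.2)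
    have hP := energy_le_gradNormSq ha hb hC1 hns
    have hprod : production f a b (U r) ≤ m * gradNormSq a b (gradLayer (U r)) := by
      -- A field with zero gradient is not admissible, but then Poincaré makes its energy, and so
      -- its production, vanish.
      rcases (gradNormSq_nonneg a b (gradLayer (U r))).eq_or_lt with h0 | h0
      · obtain ⟨C, hC0, hC⟩ := exists_abs_profileDeriv_le hf
        have hE : energy a b (U r) = 0 := by
          refine le_antisymm ?_ (energy_nonneg a b _)
          rw [← h0] at hP
          exact nonpos_of_mul_nonpos_right hP (by positivity)
        have := abs_production_le hC0 hC a b (hmem hr0 hr.2)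
        rw [hE, mul_zero] at this
        rw [← h0, mul_zero]
        exact (le_abs_self _).trans this
      · exact (div_le_iff₀ h0).1 (hm ⟨_, _, kinematicallyAdmissible_of_contDiffOn hC1
          (h.periodic_velocity r hr0 (hT hr.2)) hns (h.div_free r hr0 (hT hr.2)) h0, rfl⟩)
    have := mul_le_mul_of_nonpos_left hP hmRe.le
    linarith
  rcases hs.eq_or_lt with rfl | hs
  · rcases hst.eq_or_lt with rfl | ht
    · simp
    -- At time 0 only L² convergence is known: the initial time `s` tends to 0 for fixed ε, and only
    -- afterwards ε tends to 0.
    have hε : ∀ ε : ℝ, 0 < ε → energy a b (U t) ≤ (1 + ε) * energy a b (U 0) *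
        Real.exp (Real.pi ^ 2 / 2 * (m - 1 / Re) * (t - 0)) := by
      intro ε hε
      have hlim : Tendsto (fun s : ℝ => ((1 + ε) * energy a b (U 0) +
          (1 + ε⁻¹) / 2 * ∑ i, ∫ X in cell a b, (U s X i - U 0 X i) ^ 2) *
          Real.exp (Real.pi ^ 2 / 2 * (m - 1 / Re) * (t - s))) (𝓝[>] 0)
          (𝓝 (((1 + ε) * energy a b (U 0) + (1 + ε⁻¹) / 2 * 0) *
            Real.exp (Real.pi ^ 2 / 2 * (m - 1 / Re) * (t - 0)))) :=
        (tendsto_const_nhds.add (h.initial_tendsto.const_mul _)).mul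
          (((by fun_prop : Continuous fun s : ℝ =>
            Real.exp (Real.pi ^ 2 / 2 * (m - 1 / Re) * (t - s))).tendsto 0).mono_left
            nhdsWithin_le_nhds)
      rw [mul_zero, add_zero] at hlim
      refine ge_of_tendsto hlim ?_
      filter_upwards [Ioo_mem_nhdsGT ht] with s hs
      refine (hpos hs.1 hs.2.le).trans ?_
      gcongr
      exact energy_le_of_sub hε (hmem hs.1 hs.2.le) h.initial_memLp
    have hlim : Tendsto (fun ε : ℝ => (1 + ε) * energy a b (U 0) *
        Real.exp (Real.pi ^ 2 / 2 * (m - 1 / Re) * (t - 0))) (𝓝[>] 0)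
        (𝓝 ((1 + 0) * energy a b (U 0) *
          Real.exp (Real.pi ^ 2 / 2 * (m - 1 / Re) * (t - 0)))) :=
      ((by fun_prop : Continuous fun ε : ℝ => (1 + ε) * energy a b (U 0) *
        Real.exp (Real.pi ^ 2 / 2 * (m - 1 / Re) * (t - 0))).tendsto 0).mono_left
        nhdsWithin_le_nhds
    rw [add_zero, one_mul] at hlim
    exact ge_of_tendsto hlim (mem_of_superset self_mem_nhdsWithin hε)
  · exact hpos hs hst

end solution

/-! ### Primitives across the layer -/

/-- The integral of `ψ` over the vertical segment of length `2` below a point. For `ψ` supported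
in the open layer, this is the primitive of `ψ` in the direction `z` that vanishes on `z = -1`. -/
noncomputable def zPrimitive (ψ : Pt → ℝ) (X : Pt) : ℝ :=
  ∫ s in (0 : ℝ)..2, ψ (X - Pi.single 2 s)

section zPrimitive

variable {ψ : Pt → ℝ}

lemma continuous_single_two : Continuous fun s : ℝ => (Pi.single 2 s : Pt) :=
  continuous_single (A := fun _ : Fin 3 => ℝ) 2

/-- The primitive is the convolution of `ψ` with the length measure `μ` of a vertical segment, so it
inherits smoothness from `ψ`. -/
lemma contDiff_zPrimitive (hψ : ContDiff ℝ ∞ ψ) (hc : HasCompactSupport ψ) :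
    ContDiff ℝ ∞ (zPrimitive ψ) := by
  have hm : Measurable fun s : ℝ => (Pi.single 2 s : Pt) := continuous_single_two.measurable
  let μ : Measure Pt := (volume.restrict (Ioc (0 : ℝ) 2)).map fun s : ℝ => (Pi.single 2 s : Pt)
  have h1 : LocallyIntegrable (fun _ : Pt => (1 : ℝ)) μ :=
    (integrable_const (μ := μ) (1 : ℝ)).locallyIntegrable
  have h := hc.contDiff_convolution_right (ContinuousLinearMap.mul ℝ ℝ) h1 hψ
  convert! h using 1
  ext X
  have hcX : Continuous fun Y : Pt => ψ (X - Y) := hψ.continuous.comp (by fun_prop)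
  rw [zPrimitive, intervalIntegral.integral_of_le (by norm_num), convolution_def,
    integral_map hm.aemeasurable (by simpa using hcX.aestronglyMeasurable)]
  simp

lemma exists_norm_bound (hc : HasCompactSupport ψ) : ∃ R, ∀ X : Pt, R < ‖X‖ → ψ X = 0 := by
  obtain ⟨R, hR⟩ := hc.isCompact.isBounded.subset_closedBall 0
  exact ⟨R, fun X hX => image_eq_zero_of_notMem_tsupport fun h =>
    hX.not_ge (by simpa using hR h)⟩

lemma hasCompactSupport_zPrimitive (hc : HasCompactSupport ψ) :
    HasCompactSupport (zPrimitive ψ) := by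
  obtain ⟨R, hR⟩ := exists_norm_bound hc
  refine HasCompactSupport.intro (isCompact_closedBall (0 : Pt) (R + 2)) fun X hX => ?_
  refine intervalIntegral.integral_zero_ae (Eventually.of_forall fun s hs => hR _ ?_)
  rw [uIoc_of_le (by norm_num)] at hs
  have h1 : ‖(Pi.single 2 s : Pt)‖ ≤ 2 := by
    rw [Pi.norm_single, Real.norm_eq_abs, abs_of_pos hs.1]
    exact hs.2
  have h2 : R + 2 < ‖X‖ := by simpa using hX
  have h3 := norm_sub_norm_le X (Pi.single 2 s)
  linarith

/-- The derivative of the sliding integral is the difference of `ψ` at the two ends of the segment.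
Its length 2 is the height of the layer, so the lower end is never in the open layer and contributes
nothing; a finite length also keeps the support compact. -/
lemma pd_zPrimitive (hψ : ContDiff ℝ ∞ ψ) (hc : HasCompactSupport ψ)
    (hsupp : ∀ X ∉ openLayer, ψ X = 0) {X : Pt} (hX : X ∈ layer) :
    pd 2 (zPrimitive ψ) X = ψ X := by
  set h : ℝ → ℝ := fun σ => ψ (X + Pi.single 2 σ) with hh
  have hhc : Continuous h :=
    hψ.continuous.comp (continuous_const.add continuous_single_two)
  have hline : HasDerivAt (fun r : ℝ => X + r • (Pi.single 2 1 : Pt)) (Pi.single 2 1) 0 := by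
    simpa using ((hasDerivAt_id (0 : ℝ)).smul_const (Pi.single 2 1 : Pt)).const_add X
  have h1 : HasDerivAt (fun r : ℝ => zPrimitive ψ (X + r • (Pi.single 2 1 : Pt)))
      (pd 2 (zPrimitive ψ) X) 0 := by
    have hd : HasFDerivAt (zPrimitive ψ) (fderiv ℝ (zPrimitive ψ) X)
        (X + (0 : ℝ) • (Pi.single 2 1 : Pt)) := by
      simpa using ((contDiff_zPrimitive hψ hc).differentiable (by simp) X).hasFDerivAt
    exact hd.comp_hasDerivAt 0 hline
  have h2 : ∀ r : ℝ, zPrimitive ψ (X + r • (Pi.single 2 1 : Pt)) =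
      (∫ σ in (0 : ℝ)..r, h σ) - ∫ σ in (0 : ℝ)..(r - 2), h σ := by
    intro r
    have h3 : ∀ s : ℝ, ψ (X + r • (Pi.single 2 1 : Pt) - Pi.single 2 s) = h (r - s) := by
      intro s
      rw [hh]
      simp only
      congr 1
      rw [add_sub_assoc, ← Pi.single_smul, ← Pi.single_sub]
      simp
    simp only [zPrimitive, h3]
    rw [intervalIntegral.integral_comp_sub_left h r, sub_zero,
      intervalIntegral.integral_interval_sub_left (hhc.intervalIntegrable _ _)
        (hhc.intervalIntegrable _ _)]
  have h4 : HasDerivAt (fun r : ℝ => ∫ σ in (0 : ℝ)..(r - 2), h σ) (h (0 - 2)) 0 :=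
    HasDerivAt.comp_sub_const 0 2 (hhc.integral_hasStrictDerivAt 0 (0 - 2)).hasDerivAt
  have h5 : HasDerivAt (fun r : ℝ => zPrimitive ψ (X + r • (Pi.single 2 1 : Pt)))
      (h 0 - h (0 - 2)) 0 := by
    simp only [h2]
    exact (hhc.integral_hasStrictDerivAt 0 0).hasDerivAt.sub h4
  rw [h1.unique h5]
  have h6 : h (0 - 2) = 0 := by
    refine hsupp _ fun hmem => ?_
    have h7 := hmem.1
    simp only [Pi.add_apply, Pi.single_eq_same] at h7
    linarith [hX.2]
  rw [h6, sub_zero, hh]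
  simp

/-- Nonnegativity of the variance of `g` about its mean `m`. -/
lemma sq_intervalIntegral_le {g : ℝ → ℝ} (hg : Continuous g) :
    (∫ s in (0 : ℝ)..2, g s) ^ 2 ≤ 2 * ∫ s in (0 : ℝ)..2, g s ^ 2 := by
  set m := (∫ s in (0 : ℝ)..2, g s) / 2 with hm
  have h1 : ∫ s in (0 : ℝ)..2, (g s - m) ^ 2 =
      (∫ s in (0 : ℝ)..2, g s ^ 2) - 2 * m * (∫ s in (0 : ℝ)..2, g s) + 2 * m ^ 2 := by
    have h2 : ∀ s, (g s - m) ^ 2 = g s ^ 2 - 2 * m * g s + m ^ 2 := fun s => by ring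
    simp only [h2]
    rw [intervalIntegral.integral_add
        ((by fun_prop : Continuous fun s => g s ^ 2 - 2 * m * g s).intervalIntegrable _ _)
        (by simp), intervalIntegral.integral_sub
        ((by fun_prop : Continuous fun s => g s ^ 2).intervalIntegrable _ _)
        ((by fun_prop : Continuous fun s => 2 * m * g s).intervalIntegrable _ _),
      intervalIntegral.integral_const_mul]
    simp
  have h3 : 0 ≤ ∫ s in (0 : ℝ)..2, (g s - m) ^ 2 :=
    intervalIntegral.integral_nonneg (by norm_num) fun s _ => sq_nonneg _
  have h4 : ∫ s in (0 : ℝ)..2, g s = 2 * m := by rw [hm]; ring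
  rw [h1, h4] at h3
  rw [h4]
  nlinarith

/-- One factor 2 comes from Cauchy–Schwarz on the segment, the other from its length, after Fubini
and translation invariance. -/
lemma integral_zPrimitive_sq_le (hψ : ContDiff ℝ ∞ ψ) (hc : HasCompactSupport ψ) :
    ∫ X, zPrimitive ψ X ^ 2 ≤ 4 * ∫ X, ψ X ^ 2 := by
  have hφ := contDiff_zPrimitive hψ hc
  have hφc := hasCompactSupport_zPrimitive hc
  have hsq : ∀ {g : Pt → ℝ}, HasCompactSupport g → HasCompactSupport fun X => g X ^ 2 :=
    fun hg => hg.comp_left (g := fun x : ℝ => x ^ 2) (by simp)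
  have hi1 : Integrable fun X => zPrimitive ψ X ^ 2 :=
    (hφ.continuous.pow 2).integrable_of_hasCompactSupport (hsq hφc)
  have hi2 : Integrable fun X => ψ X ^ 2 :=
    (hψ.continuous.pow 2).integrable_of_hasCompactSupport (hsq hc)
  have hcont : Continuous fun q : Pt × ℝ => ψ (q.1 - Pi.single 2 q.2) ^ 2 :=
    (hψ.continuous.comp (continuous_fst.sub (continuous_single_two.comp continuous_snd))).pow 2
  have hshift : ∀ s : ℝ, ∫ X : Pt, ψ (X - Pi.single 2 s) ^ 2 = ∫ X, ψ X ^ 2 := fun s =>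
    integral_sub_right_eq_self (fun X => ψ X ^ 2) (Pi.single 2 s : Pt)
  have hprod : Integrable (fun q : Pt × ℝ => ψ (q.1 - Pi.single 2 q.2) ^ 2)
      (volume.prod (volume.restrict (Ioc (0 : ℝ) 2))) := by
    rw [integrable_prod_iff' hcont.aestronglyMeasurable]
    have hi3 : ∀ s : ℝ, Integrable fun X : Pt => ψ (X - Pi.single 2 s) ^ 2 := fun s =>
      hi2.comp_sub_right (Pi.single 2 s : Pt)
    refine ⟨Eventually.of_forall hi3, ?_⟩
    simp only [norm_pow, Real.norm_eq_abs, sq_abs, hshift]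
    exact integrable_const _
  have hi4 : Integrable fun X : Pt => 2 * ∫ s in Ioc (0 : ℝ) 2, ψ (X - Pi.single 2 s) ^ 2 :=
    hprod.integral_prod_left.const_mul 2
  have hle : ∀ X, zPrimitive ψ X ^ 2 ≤ 2 * ∫ s in Ioc (0 : ℝ) 2, ψ (X - Pi.single 2 s) ^ 2 := by
    intro X
    have h1 := sq_intervalIntegral_le (g := fun s => ψ (X - Pi.single 2 s))
      (hψ.continuous.comp (continuous_const.sub continuous_single_two))
    have h2 : ∫ s in (0 : ℝ)..2, ψ (X - Pi.single 2 s) ^ 2 =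
        ∫ s in Ioc (0 : ℝ) 2, ψ (X - Pi.single 2 s) ^ 2 :=
      intervalIntegral.integral_of_le (by norm_num)
    rwa [h2] at h1
  have hswap : ∫ X : Pt, ∫ s in Ioc (0 : ℝ) 2, ψ (X - Pi.single 2 s) ^ 2 =
      ∫ s in Ioc (0 : ℝ) 2, ∫ X : Pt, ψ (X - Pi.single 2 s) ^ 2 :=
    integral_integral_swap (f := fun X s => ψ (X - Pi.single 2 s) ^ 2) hprod
  calc ∫ X, zPrimitive ψ X ^ 2
      ≤ ∫ X, 2 * ∫ s in Ioc (0 : ℝ) 2, ψ (X - Pi.single 2 s) ^ 2 :=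
        integral_mono hi1 hi4 hle
    _ = 2 * ∫ s in Ioc (0 : ℝ) 2, ∫ X : Pt, ψ (X - Pi.single 2 s) ^ 2 := by
        rw [integral_const_mul, hswap]
    _ = 4 * ∫ X, ψ X ^ 2 := by
        simp only [hshift]
        simp
        ring

end zPrimitive

/-! ### Duality in `L²` -/

lemma sq_integral_mul_le {μ : Measure Pt} {u v : Pt → ℝ} (hu : MemLp u 2 μ) (hv : MemLp v 2 μ) :
    (∫ X, u X * v X ∂μ) ^ 2 ≤ (∫ X, u X ^ 2 ∂μ) * ∫ X, v X ^ 2 ∂μ := by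
  have hinner : ∀ {u v : Pt → ℝ} (hu : MemLp u 2 μ) (hv : MemLp v 2 μ),
      inner ℝ (hu.toLp u) (hv.toLp v) = ∫ X, u X * v X ∂μ := fun hu hv => by
    rw [L2.inner_def]
    refine integral_congr_ae ?_
    filter_upwards [hu.coeFn_toLp, hv.coeFn_toLp] with X h1 h2
    simp [h1, h2, mul_comm]
  have h := real_inner_mul_inner_self_le (hu.toLp u) (hv.toLp v)
  simp only [hinner, ← sq] at h
  exact h

/-- A function that is bounded, as a functional on the test functions supported in an open set of
full measure, is bounded in `L²`. -/
lemma integral_sq_le_of_forall_test {μ : Measure Pt} {O : Set Pt} (hO : IsOpen O)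
    (hOμ : ∀ᵐ X ∂μ, X ∈ O) [IsFiniteMeasure μ] {u : Pt → ℝ} (hu : MemLp u 2 μ) {C : ℝ}
    (hC : 0 ≤ C) (h : ∀ ψ : Pt → ℝ, ContDiff ℝ ∞ ψ → HasCompactSupport ψ → tsupport ψ ⊆ O →
      (∫ X, u X * ψ X ∂μ) ^ 2 ≤ C * ∫ X, ψ X ^ 2 ∂μ) :
    ∫ X, u X ^ 2 ∂μ ≤ C := by
  have hinner : ∀ v w : Lp ℝ 2 μ, inner ℝ v w = ∫ X, v X * w X ∂μ := fun v w => by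
    rw [L2.inner_def]
    simp [mul_comm]
  let K : Submodule ℝ (Lp ℝ 2 μ) :=
    { carrier := {v | ∃ ψ : Pt → ℝ, ContDiff ℝ ∞ ψ ∧ HasCompactSupport ψ ∧ tsupport ψ ⊆ O ∧
        v =ᵐ[μ] ψ}
      zero_mem' := ⟨fun _ => 0, contDiff_const, HasCompactSupport.zero,
        by simp [tsupport], Lp.coeFn_zero ℝ 2 μ⟩
      add_mem' := by
        rintro v w ⟨ψ, h1, h2, h3, h4⟩ ⟨χ, k1, k2, k3, k4⟩
        exact ⟨ψ + χ, h1.add k1, h2.add k2, (tsupport_add ψ χ).trans (union_subset h3 k3),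
          (Lp.coeFn_add v w).trans (h4.add k4)⟩
      smul_mem' := by
        rintro c v ⟨ψ, h1, h2, h3, h4⟩
        exact ⟨c • ψ, h1.const_smul c, h2.comp_left (g := fun x : ℝ => c • x) (smul_zero c),
          (closure_mono (Function.support_const_smul_subset c ψ)).trans h3,
          (Lp.coeFn_smul c v).trans (h4.const_smul c)⟩ }
  -- The fundamental lemma of the calculus of variations; it makes the test functions dense, so the
  -- bound passes to `u` itself.
  have hKorth : Kᗮ = ⊥ := by
    refine (Submodule.eq_bot_iff _).2 fun v hv => ?_
    refine Lp.eq_zero_iff_ae_eq_zero.2 ?_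
    have hloc : LocallyIntegrableOn v O μ :=
      ((Lp.memLp v).integrable one_le_two).locallyIntegrable.locallyIntegrableOn O
    have h0 := hO.ae_eq_zero_of_integral_contDiff_smul_eq_zero hloc fun ψ h1 h2 h3 => by
      have hψ : MemLp ψ 2 μ := h1.continuous.memLp_of_hasCompactSupport h2
      have := (Submodule.mem_orthogonal K v).1 hv (hψ.toLp ψ) ⟨ψ, h1, h2, h3, hψ.coeFn_toLp⟩
      rw [hinner] at this
      rw [← this]
      refine integral_congr_ae (hψ.coeFn_toLp.mono fun X hX => ?_)
      simp [hX]
    filter_upwards [h0, hOμ] with X hX hXO using hX hXO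
  have hdense : Dense (K : Set (Lp ℝ 2 μ)) :=
    Submodule.dense_iff_topologicalClosure_eq_top.2
      (Submodule.topologicalClosure_eq_top_iff.2 hKorth)
  have hall : ∀ v : Lp ℝ 2 μ, inner ℝ (hu.toLp u) v ^ 2 ≤ C * inner ℝ v v := by
    refine fun v => hdense.induction (P := fun v : Lp ℝ 2 μ =>
      inner ℝ (hu.toLp u) v ^ 2 ≤ C * inner ℝ v v) ?_ (isClosed_le (by fun_prop) (by fun_prop)) v
    rintro v ⟨ψ, h1, h2, h3, h4⟩
    rw [hinner, hinner]
    refine (Eq.trans_le ?_ (h ψ h1 h2 h3)).trans_eq ?_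
    · congr 1
      refine integral_congr_ae ?_
      filter_upwards [h4, hu.coeFn_toLp] with X hX hX' using by rw [hX, hX']
    · congr 1
      refine integral_congr_ae ?_
      filter_upwards [h4] with X hX using by rw [hX, sq]
  have hself : inner ℝ (hu.toLp u) (hu.toLp u) = ∫ X, u X ^ 2 ∂μ := by
    rw [hinner]
    refine integral_congr_ae ?_
    filter_upwards [hu.coeFn_toLp] with X hX using by rw [hX, sq]
  have hu2 := hall (hu.toLp u)
  rw [hself] at hu2
  have hpos : 0 ≤ ∫ X, u X ^ 2 ∂μ := integral_nonneg fun X => sq_nonneg _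
  rcases hpos.eq_or_lt with h0 | h0
  · rwa [← h0]
  · rw [sq] at hu2
    exact le_of_mul_le_mul_right hu2 h0

/-! ### The Reynolds-Orr ratio is bounded -/

instance (a b : ℝ) : IsFiniteMeasure (volume.restrict (cell a b)) :=
  ⟨by simpa using (isCompact_cell a b).measure_lt_top⟩

/-- A Poincaré inequality for kinematically admissible fields. -/
lemma KinematicallyAdmissible.integral_sq_le {a b : ℝ} {U : Pt → Fin 3 → ℝ}
    {G : Pt → Fin 3 → Fin 3 → ℝ} (h : KinematicallyAdmissible a b U G) (i : Fin 3) :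
    ∫ X in cell a b, U X i ^ 2 ≤ 4 * ∫ X in cell a b, G X i 2 ^ 2 := by
  have hG0 : 0 ≤ ∫ X in cell a b, G X i 2 ^ 2 := integral_nonneg fun X => sq_nonneg _
  set O : Set Pt := pi univ fun k => Ioo ((![0, 0, -1] : Pt) k)
    ((![2 * Real.pi / a, 2 * Real.pi / b, 1] : Pt) k)
  have hO : IsOpen O := isOpen_set_pi finite_univ fun _ _ => isOpen_Ioo
  have hOae : ∀ᵐ X ∂(volume.restrict (cell a b)), X ∈ O := ae_mem_interior _ _
  have hG4 : 0 ≤ 4 * ∫ X in cell a b, G X i 2 ^ 2 := by linarith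
  refine integral_sq_le_of_forall_test hO hOae (h.memLp i) hG4 fun ψ hψ hc hsupp => ?_
  have hψO : ∀ X ∉ openLayer, ψ X = 0 := fun X hX =>
    image_eq_zero_of_notMem_tsupport fun hX' => hX (pi_Ioo_subset_openLayer rfl rfl (hsupp hX'))
  have hψcell : ∀ X ∉ cell a b, ψ X = 0 := fun X hX =>
    image_eq_zero_of_notMem_tsupport fun hX' => hX (by
      have h1 := hsupp hX'
      exact ⟨fun k => (h1 k (mem_univ k)).1.le, fun k => (h1 k (mem_univ k)).2.le⟩)
  have hφ := contDiff_zPrimitive hψ hc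
  have hφc := hasCompactSupport_zPrimitive hc
  -- Integration is vertical, so the primitive stays over the horizontal section of the cell.
  have hφcell : ∀ X ∈ layer \ cell a b, zPrimitive ψ X = 0 := by
    intro X hX
    refine intervalIntegral.integral_zero_ae (Eventually.of_forall fun s _ => ?_)
    refine image_eq_zero_of_notMem_tsupport fun hX' => hX.2 ?_
    have h1 := hsupp hX'
    have h2 : ∀ k : Fin 3, k ≠ 2 → (X - Pi.single 2 s : Pt) k = X k := fun k hk => by simp [hk]
    refine ⟨fun k => ?_, fun k => ?_⟩ <;> by_cases hk : k = 2
    · subst hk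
      exact hX.1.1
    · exact (h2 k hk) ▸ (h1 k (mem_univ k)).1.le
    · subst hk
      exact hX.1.2
    · exact (h2 k hk) ▸ (h1 k (mem_univ k)).2.le
  have h1 : ∫ X in cell a b, U X i * ψ X = ∫ X in layer, U X i * pd 2 (zPrimitive ψ) X := by
    rw [setIntegral_congr_fun (g := fun X => U X i * ψ X) isClosed_layer.measurableSet fun X hX =>
      by rw [pd_zPrimitive hψ hc hψO hX]]
    refine (setIntegral_eq_of_subset_of_forall_sdiff_eq_zero isClosed_layer.measurableSet
      (cell_subset_layer a b) fun X hX => ?_).symm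
    rw [hψcell X hX.2, mul_zero]
  have h2 : ∫ X in layer, G X i 2 * zPrimitive ψ X = ∫ X in cell a b, G X i 2 * zPrimitive ψ X := by
    refine setIntegral_eq_of_subset_of_forall_sdiff_eq_zero isClosed_layer.measurableSet
      (cell_subset_layer a b) fun X hX => ?_
    rw [hφcell X hX, mul_zero]
  have hsqc : HasCompactSupport fun X => zPrimitive ψ X ^ 2 :=
    hφc.comp_left (g := fun x : ℝ => x ^ 2) (by simp)
  have hφi : Integrable fun X => zPrimitive ψ X ^ 2 :=
    (hφ.continuous.pow 2).integrable_of_hasCompactSupport hsqc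
  have h3 : ∫ X in cell a b, zPrimitive ψ X ^ 2 ≤ ∫ X, zPrimitive ψ X ^ 2 :=
    setIntegral_le_integral hφi (Eventually.of_forall fun X => sq_nonneg _)
  have h4 : ∫ X in cell a b, ψ X ^ 2 = ∫ X, ψ X ^ 2 :=
    setIntegral_eq_integral_of_forall_compl_eq_zero fun X hX => by rw [hψcell X hX]; simp
  -- The primitive need not vanish on z = 1, so the zero-trace part of `weak_grad` is needed here.
  rw [h1, h.weak_grad _ hφ hφc, neg_sq, h2]
  calc _ ≤ (∫ X in cell a b, G X i 2 ^ 2) * ∫ X in cell a b, zPrimitive ψ X ^ 2 :=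
        sq_integral_mul_le (h.memLp_grad i 2) (hφ.continuous.memLp_of_hasCompactSupport hφc)
    _ ≤ (∫ X in cell a b, G X i 2 ^ 2) * (4 * ∫ X in cell a b, ψ X ^ 2) := by
        rw [h4]
        exact mul_le_mul_of_nonneg_left (h3.trans (integral_zPrimitive_sq_le hψ hc)) hG0
    _ = 4 * (∫ X in cell a b, G X i 2 ^ 2) * ∫ X in cell a b, ψ X ^ 2 := by ring

/-- Any finite bound suffices, so the Poincaré constant 4 need not be sharp. Without a bound, `sSup`
would take its default value 0. -/
lemma bddAbove_ratioSet {f : ℝ → ℝ} (hf : ContDiffOn ℝ 1 f (Icc (-1) 1)) (a b : ℝ) :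
    BddAbove (ratioSet f a b) := by
  obtain ⟨C, hC0, hC⟩ := exists_abs_profileDeriv_le hf
  refine ⟨2 * C, ?_⟩
  rintro _ ⟨U, G, h, rfl⟩
  rw [div_le_iff₀ h.grad_pos]
  have hE : energy a b U ≤ 2 * gradNormSq a b G := by
    have h1 : ∑ i, ∫ X in cell a b, U X i ^ 2 ≤ ∑ i, 4 * ∑ j, ∫ X in cell a b, G X i j ^ 2 := by
      refine Finset.sum_le_sum fun i _ => (h.integral_sq_le i).trans ?_
      gcongr
      exact Finset.single_le_sum (f := fun j => ∫ X in cell a b, G X i j ^ 2)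
        (fun j _ => integral_nonneg fun X => sq_nonneg _) (Finset.mem_univ 2)
    rw [← Finset.mul_sum] at h1
    rw [energy, gradNormSq]
    linarith
  have h2 := (le_abs_self _).trans (abs_production_le hC0 hC a b h.memLp)
  nlinarith [mul_le_mul_of_nonneg_left hE hC0]

lemma volume_cell_pos {a b : ℝ} (ha : 0 < a) (hb : 0 < b) : 0 < volume (cell a b) := by
  rw [cell, Real.volume_Icc_pi, Fin.prod_univ_three]
  have h1 : 0 < 2 * Real.pi / a := by positivity
  have h2 : 0 < 2 * Real.pi / b := by positivity
  simp [pos_iff_ne_zero, h1, h2]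

/-- The parallel flow `(1 - z²) i` is kinematically admissible, without any production. -/
lemma zero_mem_ratioSet (f : ℝ → ℝ) {a b : ℝ} (ha : 0 < a) (hb : 0 < b) :
    0 ∈ ratioSet f a b := by
  set U : Pt → Fin 3 → ℝ := fun X => ![1 - X 2 ^ 2, 0, 0] with hUdef
  have hU : ContDiff ℝ 1 U := by
    refine contDiff_pi.2 fun i => ?_
    have h1 : ContDiff ℝ 1 fun X : Pt => 1 - X 2 ^ 2 :=
      contDiff_const.sub ((contDiff_apply ℝ ℝ 2).pow 2)
    match i with
    | 0 => exact h1
    | 1 => exact contDiff_const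
    | 2 => exact contDiff_const
  have h0 : ∀ X : Pt, X 2 = -1 ∨ X 2 = 1 → U X = 0 := by
    intro X hX
    have : 1 - X 2 ^ 2 = 0 := by rcases hX with h | h <;> rw [h] <;> norm_num
    ext i
    fin_cases i <;> simp [hUdef, this]
  have hper : PeriodicXY a b U := fun X _ => by simp [hUdef]
  have hdiv : ∀ X ∈ openLayer, ∑ i, pd i (fun Y => U Y i) X = 0 := by
    intro X _
    have h1 : pd 0 (fun Y : Pt => 1 - Y 2 ^ 2) X = 0 := by
      have := (pd_comp_apply (j := 0) (k := 2) (X := X)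
        ((hasDerivAt_pow 2 (X 2)).const_sub 1)).2
      simpa using this
    have h2 : ∀ k : Fin 3, pd k (fun _ : Pt => (0 : ℝ)) X = 0 := fun k => by simp [pd]
    rw [Fin.sum_univ_three]
    simp only [hUdef, Matrix.cons_val, h1, h2]
    norm_num
  have hint : 0 < ∫ X in cell a b, U X 0 ^ 2 := by
    refine (integral_nonneg fun X => sq_nonneg (U X 0)).lt_of_ne' fun hzero => ?_
    have hi : IntegrableOn (fun X => U X 0 ^ 2) (cell a b) :=
      integrableOn_cell ((contDiff_pi.1 hU 0).continuous.pow 2).continuousOn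
    have hae := (integral_eq_zero_iff_of_nonneg (fun X => sq_nonneg (U X 0)) hi).1 hzero
    have hfalse : ∀ᵐ X ∂(volume.restrict (cell a b)), False := by
      filter_upwards [hae, ae_cell_mem_openLayer a b] with X hX hXO
      have h1 : 1 - X 2 ^ 2 = 0 := pow_eq_zero_iff two_ne_zero |>.1 hX
      nlinarith [hXO.1, hXO.2]
    have hbot : volume (cell a b) = 0 := by
      simpa [ae_iff] using hfalse
    exact (volume_cell_pos ha hb).ne' hbot
  -- Positive energy forces a positive gradient norm by Poincaré, which avoids computing the
  -- gradient.
  have hE : 0 < energy a b U := by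
    have h1 : ∀ i, 0 ≤ ∫ X in cell a b, U X i ^ 2 := fun i =>
      integral_nonneg fun X => sq_nonneg _
    rw [energy, Fin.sum_univ_three]
    linarith [h1 1, h1 2]
  have hpos : 0 < gradNormSq a b (gradLayer U) :=
    lt_of_lt_of_le (by positivity) (energy_le_gradNormSq ha hb hU.contDiffOn h0)
  refine ⟨U, _, kinematicallyAdmissible_of_contDiffOn hU.contDiffOn hper h0 hdiv hpos, ?_⟩
  simp [production, hUdef]

/-- Since 0 is a value of the ratio, the supremum is nonnegative and `ENNReal.ofReal` does not
truncate it. -/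
lemma isLUB_ratioSet {f : ℝ → ℝ} (hf : ContDiffOn ℝ 1 f (Icc (-1) 1)) {a b : ℝ} (ha : 0 < a)
    (hb : 0 < b) : IsLUB (ratioSet f a b) (criticalRe f a b)⁻¹.toReal := by
  have hbdd := bddAbove_ratioSet hf a b
  have h0 := zero_mem_ratioSet f ha hb
  rw [criticalRe, inv_inv, ENNReal.toReal_ofReal (le_csSup hbdd h0)]
  exact isLUB_csSup ⟨0, h0⟩ hbdd

end ShearFlow

theorem theorem3p1 (f : ℝ → ℝ) (hf : ContDiffOn ℝ 1 f (Set.Icc (-1) 1))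
    (a b Re : ℝ) (ha : 0 < a) (hb : 0 < b) (hRe : 0 < Re)
    (hcrit : ENNReal.ofReal Re < ShearFlow.criticalRe f a b) :
    IsLUB (ShearFlow.ratioSet f a b) (ShearFlow.criticalRe f a b)⁻¹.toReal ∧
    (ShearFlow.criticalRe f a b)⁻¹.toReal - 1 / Re < 0 ∧
    ∀ (T : EReal) (U : ℝ → ShearFlow.Pt → Fin 3 → ℝ) (p : ℝ → ShearFlow.Pt → ℝ),
      ShearFlow.IsPerturbation f Re a b T U p →
        AntitoneOn (fun t => ShearFlow.energy a b (U t)) {t : ℝ | 0 ≤ t ∧ (t : EReal) < T} ∧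
        (∀ s t : ℝ, 0 ≤ s → s < t → (t : EReal) < T → 0 < ShearFlow.energy a b (U s) →
          ShearFlow.energy a b (U t) < ShearFlow.energy a b (U s)) ∧
        ∀ t : ℝ, 0 ≤ t → (t : EReal) < T →
          ShearFlow.energy a b (U t) ≤ ShearFlow.energy a b (U 0) *
            Real.exp (Real.pi ^ 2 / 2 *
              ((ShearFlow.criticalRe f a b)⁻¹.toReal - 1 / Re) * t) := by
  have hlub := ShearFlow.isLUB_ratioSet hf ha hb
  have hneg : (ShearFlow.criticalRe f a b)⁻¹.toReal - 1 / Re < 0 := by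
    -- Inverting in `ℝ≥0∞` covers the case of an infinite critical Reynolds number.
    have h1 : (ShearFlow.criticalRe f a b)⁻¹ < ENNReal.ofReal (1 / Re) := by
      rw [one_div, ENNReal.ofReal_inv_of_pos hRe]
      exact ENNReal.inv_lt_inv.2 hcrit
    exact sub_neg.2 ((ENNReal.toReal_lt_of_lt_ofReal h1))
  refine ⟨hlub, hneg, fun T U p h => ?_⟩
  have hdecay : ∀ {s t : ℝ}, 0 ≤ s → s ≤ t → (t : EReal) < T → _ := fun hs hst ht =>
    h.energy_le_mul_exp hf ha hb hlub.1 hneg hs hst ht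
  have hrate : Real.pi ^ 2 / 2 * ((ShearFlow.criticalRe f a b)⁻¹.toReal - 1 / Re) < 0 :=
    mul_neg_of_pos_of_neg (by positivity) hneg
  refine ⟨fun s hs t ht hst => ?_, fun s t hs hst ht hE => ?_, fun t ht htT => ?_⟩
  · refine (hdecay hs.1 hst ht.2).trans ?_
    refine mul_le_of_le_one_right (ShearFlow.energy_nonneg a b _) (Real.exp_le_one_iff.2 ?_)
    exact mul_nonpos_of_nonpos_of_nonneg hrate.le (sub_nonneg.2 hst)
  · refine (hdecay hs hst.le ht).trans_lt ?_
    refine mul_lt_of_lt_one_right hE (Real.exp_lt_one_iff.2 ?_)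
    exact mul_neg_of_neg_of_pos hrate (sub_pos.2 hst)
  · simpa using hdecay le_rfl ht htT
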